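/- Let $k\ge 3$ be an even integer, $\phi=e^{2\pi \mathbf i/k}$, $\Phi=\{z\in\mathbb C: z^k=1\}$, $\mathbf k=\{1,\dots,k-1\}$, and $c_{i,j}=\frac{\phi^j-1}{\phi^i-1}$ for $i,j\in\mathbf k$. A quadruple $(i,j\mid s,t)\in\mathbf k^4$ with $i\ne s$ is an overlap if $\Phi c_{i,j}=\Phi c_{s,t}$. It is called nontrivial if for none of the pairs $(i,j),(s,t),(i,s),(j,t)$ the two entries are equal or have sum $k$. Let $\mathcal O$ be the set of nontrivial overlaps. Write $o\sim o'$ if $o'$ arises from $o$ by applying to the four entries an element of the dihedral group of order $8$ generated by the permutations $(i,t)$, $(j,s)$, $(i,j)(s,t)$, and then replacing any of the entries $x$ by $k-x$. A quadruple is normalized if $0<i<j\le s<t\le k/2$. A nontrivial triple overlap $(s_1,t_1\mid s_2,t_2\mid s_3,t_3)$ is one for which its constituents $(s_1,t_1\mid s_2,t_2)$, $(s_2,t_2\mid s_3,t_3)$, $(s_1,t_1\mid s_3,t_3)$ all lie in $\mathcal O$. If $\mathcal O\neq\emptyset$, then $6\mid k$. Moreover $\mathcal O=\mathcal O_1\cup\mathcal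 O_{30}\cup\mathcal O_{42}\cup\mathcal O_{60}$, where $\mathcal O_1$ is empty unless $6\mid k$, $\mathcal O_N$ ($N=30,42,60$) is empty unless $N\mid k$, and otherwise: (1) For $k=6\ell$, $\mathcal O_1$ consists of all quadruples $\sim(u,\ell\mid 2u,3\ell-u)$ with $1\le u\le\lfloor k/4\rfloor$, $u\ne\ell$; for these $u$, $\phi^{\ell-u}\,\frac{\phi^\ell-1}{\phi^u-1}=\frac{\phi^{3\ell-u}-1}{\phi^{2u}-1}$. In (2)–(4), $\mathcal O_N$ consists of all quadruples equivalent to a listed one, the listed quadruples are exactly the normalized elements of $\mathcal O_N$, and $\phi^\omega c_{i,j}=c_{s,t}$ holds with the listed $\omega$. (2) For $k=30m$: $(m,3m\mid 3m,11m)$, $\omega=3m$; $(3m,5m\mid 5m,9m)$, $\omega=m$ [$T_1$]; $(7m,9m\mid 9m,13m)$, $\omega=m$; $(m,2m\mid 4m,9m)$, $\omega=2m$ [$T_2$]; $(2m,3m\mid 5m,8m)$, $\omega=m$ [$T_3,T_4$]; $(8m,9m\mid 11m,14m)$, $\omega=m$ [$T_5$]; $(2m,3m\mid 7m,14m)$,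 $\omega=3m$ [$T_3$]; $(3m,4m\mid 8m,13m)$, $\omega=2m$ [$T_4$]; $(4m,5m\mid 9m,14m)$, $\omega=2m$ [$T_2,T_5$]. Here $T_1=(3m,5m\mid5m,9m\mid6m,12m)$, $T_2=(m,2m\mid4m,9m\mid5m,14m)$, $T_3=(2m,3m\mid5m,8m\mid7m,14m)$, $T_4=(2m,5m\mid3m,8m\mid4m,13m)$, $T_5=(4m,5m\mid8m,11m\mid9m,14m)$ are nontrivial triple overlaps, and a mark $[T_r]$ says that the quadruple is equivalent to a constituent of $T_r$. (3) For $k=42m$: $(2m,3m\mid 9m,16m)$, $\omega=3m$; $(3m,4m\mid 10m,15m)$, $\omega=2m$; $(8m,9m\mid 15m,20m)$, $\omega=2m$. (4) For $k=60m$: $(3m,4m\mid 16m,27m)$, $\omega=5m$; $(5m,6m\mid 18m,25m)$, $\omega=3m$; $(8m,9m\mid 21m,28m)$, $\omega=3m$. -/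

import Mathlib

namespace CircularOverlap

/-- A quadruple `(i, j | s, t)` of exponents. -/
@[ext] structure Quad where
  i : ℕ
  j : ℕ
  s : ℕ
  t : ℕ

/-- The primitive `k`-th root of unity `φ = exp (2πi/k)`. -/
noncomputable def phi (k : ℕ) : ℂ :=
  Complex.exp (2 * (Real.pi : ℂ) * Complex.I / (k : ℂ))

/-- The group `Φ` of all complex `k`-th roots of unity, as a set. -/
def Phi (k : ℕ) : Set ℂ := {z | z ^ k = 1}

/-- The quotient `c_{i,j} = (φ^j - 1) / (φ^i - 1)`. -/
noncomputable def c (k i j : ℕ) : ℂ := (phi k ^ j - 1) / (phi k ^ i - 1)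

/-- The coset `Φ x`. -/
def coset (k : ℕ) (x : ℂ) : Set ℂ := (fun z => z * x) '' Phi k

/-- The exponent set `{1, …, k - 1}`. -/
def exps (k : ℕ) : Set ℕ := {x | 1 ≤ x ∧ x < k}

/-- All four entries lie in `{1, …, k - 1}`. -/
def Quad.InRange (k : ℕ) (o : Quad) : Prop :=
  o.i ∈ exps k ∧ o.j ∈ exps k ∧ o.s ∈ exps k ∧ o.t ∈ exps k

/-- `(i, j | s, t)` is an overlap: entries in `{1, …, k - 1}`, `i ≠ s`, `Φ c_{i,j} = Φ c_{s,t}`. -/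
def IsOverlap (k : ℕ) (o : Quad) : Prop :=
  o.InRange k ∧ o.i ≠ o.s ∧ coset k (c k o.i o.j) = coset k (c k o.s o.t)

/-- The quadruples that can only give trivial overlaps: for one of the pairs `(i, j)`, `(s, t)`,
`(i, s)`, `(j, t)` the two entries are equal or add up to `k`. (For even `k` the overlaps among
these are those of the forms `(i, i | s, s)` and `(i, j | i, j)`, with entries `x` possibly
replaced by `k - x`.) -/
def Quad.Trivial (k : ℕ) (o : Quad) : Prop :=
  (o.i = o.j ∨ o.i + o.j = k) ∨ (o.s = o.t ∨ o.s + o.t = k) ∨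
  (o.i = o.s ∨ o.i + o.s = k) ∨ (o.j = o.t ∨ o.j + o.t = k)

/-- The set `𝒪 = 𝒪(ℂ, k)` of nontrivial overlaps. -/
def O (k : ℕ) : Set Quad := {o | IsOverlap k o ∧ ¬ o.Trivial k}

/-- The eight rearrangements of a quadruple by the dihedral group generated by
the permutations `(i,t)`, `(j,s)` and `(i,j)(s,t)` of its entries. -/
def Quad.rearrangements (o : Quad) : List Quad :=
  [⟨o.i, o.j, o.s, o.t⟩, ⟨o.t, o.j, o.s, o.i⟩, ⟨o.i, o.s, o.j, o.t⟩, ⟨o.t, o.s, o.j, o.i⟩,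
   ⟨o.s, o.t, o.i, o.j⟩, ⟨o.j, o.i, o.t, o.s⟩, ⟨o.j, o.t, o.i, o.s⟩, ⟨o.s, o.i, o.t, o.j⟩]

/-- `y` is `x` or `k - x`. -/
def Flip (k x y : ℕ) : Prop := y = x ∨ y = k - x

/-- `o ∼ o'`: `o'` arises from `o` by one of the eight rearrangements, followed by replacing
any of the entries `x` by `k - x`. -/
def Sim (k : ℕ) (o o' : Quad) : Prop :=
  ∃ p ∈ o.rearrangements,
    Flip k p.i o'.i ∧ Flip k p.j o'.j ∧ Flip k p.s o'.s ∧ Flip k p.t o'.t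

/-- The normalized form: `0 < i < j ≤ s < t ≤ k / 2`. -/
def Quad.Normalized (k : ℕ) (o : Quad) : Prop :=
  0 < o.i ∧ o.i < o.j ∧ o.j ≤ o.s ∧ o.s < o.t ∧ 2 * o.t ≤ k

/-- For `k = 30 m`: the quadruples of the list, each with its value `ω`. -/
def rows30 (m : ℕ) : List (Quad × ℕ) :=
  [(⟨m, 3 * m, 3 * m, 11 * m⟩, 3 * m),
   (⟨3 * m, 5 * m, 5 * m, 9 * m⟩, m),
   (⟨7 * m, 9 * m, 9 * m, 13 * m⟩, m),
   (⟨m, 2 * m, 4 * m, 9 * m⟩, 2 * m),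
   (⟨2 * m, 3 * m, 5 * m, 8 * m⟩, m),
   (⟨8 * m, 9 * m, 11 * m, 14 * m⟩, m),
   (⟨2 * m, 3 * m, 7 * m, 14 * m⟩, 3 * m),
   (⟨3 * m, 4 * m, 8 * m, 13 * m⟩, 2 * m),
   (⟨4 * m, 5 * m, 9 * m, 14 * m⟩, 2 * m)]

/-- For `k = 42 m`: the quadruples of the list, each with its value `ω`. -/
def rows42 (m : ℕ) : List (Quad × ℕ) :=
  [(⟨2 * m, 3 * m, 9 * m, 16 * m⟩, 3 * m),
   (⟨3 * m, 4 * m, 10 * m, 15 * m⟩, 2 * m),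
   (⟨8 * m, 9 * m, 15 * m, 20 * m⟩, 2 * m)]

/-- For `k = 60 m`: the quadruples of the list, each with its value `ω`. -/
def rows60 (m : ℕ) : List (Quad × ℕ) :=
  [(⟨3 * m, 4 * m, 16 * m, 27 * m⟩, 5 * m),
   (⟨5 * m, 6 * m, 18 * m, 25 * m⟩, 3 * m),
   (⟨8 * m, 9 * m, 21 * m, 28 * m⟩, 3 * m)]

/-- The family `𝒪₁` (empty unless `k = 6 ℓ`): everything equivalent to some
`(u, ℓ | 2u, 3ℓ - u)` with `1 ≤ u ≤ ⌊k/4⌋`, `u ≠ ℓ`. -/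
def O1 (k : ℕ) : Set Quad :=
  {o | ∃ l u : ℕ, k = 6 * l ∧ 1 ≤ u ∧ u ≤ k / 4 ∧ u ≠ l ∧ Sim k ⟨u, l, 2 * u, 3 * l - u⟩ o}

/-- The family attached to a list of rows, empty unless `k` is a multiple of `N`. -/
def OFamily (N : ℕ) (rows : ℕ → List (Quad × ℕ)) (k : ℕ) : Set Quad :=
  {o | ∃ m : ℕ, k = N * m ∧ ∃ r ∈ rows m, Sim k r.1 o}

/-- The family `𝒪₃₀`. -/
def O30 (k : ℕ) : Set Quad := OFamily 30 rows30 k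

/-- The family `𝒪₄₂`. -/
def O42 (k : ℕ) : Set Quad := OFamily 42 rows42 k

/-- The family `𝒪₆₀`. -/
def O60 (k : ℕ) : Set Quad := OFamily 60 rows60 k

/-- A triple `(s₁, t₁ | s₂, t₂ | s₃, t₃)` of pairs of exponents. -/
structure Triple where
  s₁ : ℕ
  t₁ : ℕ
  s₂ : ℕ
  t₂ : ℕ
  s₃ : ℕ
  t₃ : ℕ

/-- The three constituents of a triple. -/
def Triple.constituents (T : Triple) : List Quad :=
  [⟨T.s₁, T.t₁, T.s₂, T.t₂⟩, ⟨T.s₂, T.t₂, T.s₃, T.t₃⟩, ⟨T.s₁, T.t₁, T.s₃, T.t₃⟩]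

/-- The set `𝒯` of nontrivial triple overlaps: all constituents are nontrivial overlaps. -/
def TripleOverlaps (k : ℕ) : Set Triple := {T | ∀ o ∈ T.constituents, o ∈ O k}

/-- For `k = 30 m`: the triple overlaps `T₁, …, T₅`. -/
def T1 (m : ℕ) : Triple := ⟨3 * m, 5 * m, 5 * m, 9 * m, 6 * m, 12 * m⟩
def T2 (m : ℕ) : Triple := ⟨m, 2 * m, 4 * m, 9 * m, 5 * m, 14 * m⟩
def T3 (m : ℕ) : Triple := ⟨2 * m, 3 * m, 5 * m, 8 * m, 7 * m, 14 * m⟩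
def T4 (m : ℕ) : Triple := ⟨2 * m, 5 * m, 3 * m, 8 * m, 4 * m, 13 * m⟩
def T5 (m : ℕ) : Triple := ⟨4 * m, 5 * m, 8 * m, 11 * m, 9 * m, 14 * m⟩

/-- For `k = 30 m`: the pairs (quadruple of the list, triple overlap it takes part in). -/
def tripleColumn (m : ℕ) : List (Quad × Triple) :=
  [(⟨3 * m, 5 * m, 5 * m, 9 * m⟩, T1 m),
   (⟨m, 2 * m, 4 * m, 9 * m⟩, T2 m),
   (⟨2 * m, 3 * m, 5 * m, 8 * m⟩, T3 m),
   (⟨2 * m, 3 * m, 5 * m, 8 * m⟩, T4 m),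
   (⟨8 * m, 9 * m, 11 * m, 14 * m⟩, T5 m),
   (⟨2 * m, 3 * m, 7 * m, 14 * m⟩, T3 m),
   (⟨3 * m, 4 * m, 8 * m, 13 * m⟩, T4 m),
   (⟨4 * m, 5 * m, 9 * m, 14 * m⟩, T2 m),
   (⟨4 * m, 5 * m, 9 * m, 14 * m⟩, T5 m)]

/-- For `k = N m`, the rows of a list are exactly the normalized members of its family, and the
value `ω` of each row satisfies `φ^ω c_{i,j} = c_{s,t}`. -/
def RowsCorrect (N : ℕ) (rows : ℕ → List (Quad × ℕ)) (k : ℕ) : Prop :=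
  ∀ m : ℕ, k = N * m →
    (∀ o : Quad, (o ∈ OFamily N rows k ∧ o.Normalized k) ↔ ∃ r ∈ rows m, r.1 = o) ∧
    (∀ r ∈ rows m, phi k ^ r.2 * c k r.1.i r.1.j = c k r.1.s r.1.t)

end CircularOverlap

namespace CircularOverlap

/-! Absolute values turn an overlap into `sin (πi/k) sin (πt/k) = sin (πj/k) sin (πs/k)`, since
`|φ^x - 1| = 2 sin (πx/k)`. By product-to-sum this says that four cosines of rational angles add up
to zero, so eight roots of unity, closed under inversion, have sum zero. Such sums are classified in
`cosRelation_or_small_order`, which carries the proof.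

The classification is a descent on the order `N` of the roots. Replacing `ζ` by its conjugates shows
that the partial sums over exponent classes modulo `d` vanish if every prime factor of `d` divides
`N / d`, and form a geometric progression if `d` is a prime dividing `N` exactly once. Either all
exponents are divisible by that prime and the order drops, or one gets a proper relation among at
most four of the roots (`CosRelation`), or the prime is 7 and all eight exponents together hit every
class. What survives has order dividing 60 or 42.

A `CosRelation` is solved by elementary angle inequalities and yields exactly the one-parameter
family. For order 60 or 42 a finite search remains; it is done in `ZMod p`, where `p` is a prime
with `p ≡ 1` modulo `2k`, because a vanishing sum of powers of `ζ` stays zero there. The survivors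
of the search are the sporadic rows, rescaled to general `k`.

Conversely, each listed quadruple satisfies its identity with `ω` because the difference of both
sides is a multiple of a cyclotomic polynomial. Evenness of `k` makes `-1` a `k`-th root of unity,
so that replacing `x` by `k - x` preserves overlaps; this also allows every overlap to be brought
into normalized form. -/

/-! ### Vanishing sums of roots of unity and their class sums -/

theorem _root_.IsPrimitiveRoot.zpow_eq_pow_toNat {F : Type*} [Field F] {N : ℕ} {x : F}
    (hx : IsPrimitiveRoot x N) (hN : 0 < N) (a : ℤ) : x ^ a = x ^ (a % N).toNat := by
  have h1 : ((a % N).toNat : ℤ) = a % N :=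
    Int.toNat_of_nonneg (Int.emod_nonneg _ (by exact_mod_cast hN.ne'))
  rw [← zpow_natCast, h1]
  conv_lhs => rw [← Int.emod_add_mul_ediv a N]
  rw [zpow_add₀ (hx.ne_zero hN.ne'), zpow_mul, zpow_natCast, hx.pow_eq_one, one_zpow, mul_one]

open Polynomial in
/-- A vanishing sum of powers of a primitive complex root of unity stays zero when the root is
replaced by a primitive root of the same order in any field. -/
theorem sum_zpow_transfer {F ι : Type*} [Field F] {N : ℕ} (hN : 0 < N) {ζ : ℂ} {g : F}
    (hζ : IsPrimitiveRoot ζ N) (hg : IsPrimitiveRoot g N) (s : Finset ι) (e : ι → ℤ)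
    (h : ∑ i ∈ s, ζ ^ e i = 0) : ∑ i ∈ s, g ^ e i = 0 := by
  let P : ℤ[X] := ∑ i ∈ s, X ^ (e i % N).toNat
  have hP : aeval ζ P = 0 := by
    simp only [P, map_sum, map_pow, aeval_X]
    rw [← h]
    exact Finset.sum_congr rfl fun i _ => (hζ.zpow_eq_pow_toNat hN _).symm
  -- The cyclotomic polynomial is the minimal polynomial of `ζ` over `ℤ`, and it also kills `g`.
  have hd : cyclotomic N ℤ ∣ P := by
    rw [cyclotomic_eq_minpoly hζ hN]
    exact minpoly.isIntegrallyClosed_dvd (hζ.isIntegral hN) hP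
  obtain ⟨Q, hQ⟩ := hd
  have hr : aeval g (cyclotomic N ℤ) = 0 := by
    have := hg.isRoot_cyclotomic hN
    rw [← map_cyclotomic_int, IsRoot.def, eval_map] at this
    exact this
  have h2 : aeval g P = 0 := by rw [hQ, map_mul, hr, zero_mul]
  simp only [P, map_sum, map_pow, aeval_X] at h2
  rw [← h2]
  exact Finset.sum_congr rfl fun i _ => hg.zpow_eq_pow_toNat hN _

/-- Discrete Fourier inversion: if all but at most one of the twisted sums vanish, then the
class sums modulo `d` form a geometric progression. -/
theorem class_sums_of_twists {ι : Type*} (s : Finset ι) (e : ι → ℤ) (w : ι → ℂ) {d : ℕ}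
    (hd : 0 < d) {η : ℂ} (hη : IsPrimitiveRoot η d) (j₀ : ℕ) (hj₀ : j₀ < d)
    (h : ∀ j < d, j ≠ j₀ → ∑ i ∈ s, w i * η ^ ((j : ℤ) * e i) = 0) :
    ∃ c : ℂ, (c = 0 ∨ ∑ i ∈ s, w i * η ^ ((j₀ : ℤ) * e i) ≠ 0) ∧ ∀ r : ℤ,
      ∑ i ∈ s with (d : ℤ) ∣ e i - r, w i = c * η ^ (-(j₀ : ℤ) * r) := by
  have hη0 := hη.ne_zero hd.ne'
  have hd0 : (d : ℂ) ≠ 0 := by exact_mod_cast hd.ne'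
  refine ⟨(∑ i ∈ s, w i * η ^ ((j₀ : ℤ) * e i)) / d, ?_, fun r => ?_⟩
  · by_cases h0 : ∑ i ∈ s, w i * η ^ ((j₀ : ℤ) * e i) = 0
    · left; rw [h0, zero_div]
    · right; exact h0
  -- The same double sum is evaluated twice: only `j₀` survives by hypothesis, while orthogonality
  -- of the characters of `ℤ/d` leaves `d` times one class sum.
  have h1 : ∑ j ∈ Finset.range d, η ^ (-(j : ℤ) * r) * ∑ i ∈ s, w i * η ^ ((j : ℤ) * e i) =
      η ^ (-(j₀ : ℤ) * r) * ∑ i ∈ s, w i * η ^ ((j₀ : ℤ) * e i) := by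
    refine Finset.sum_eq_single_of_mem _ (Finset.mem_range.2 hj₀) fun j hj hne => ?_
    rw [h j (Finset.mem_range.1 hj) hne, mul_zero]
  have h2 : ∑ j ∈ Finset.range d, η ^ (-(j : ℤ) * r) * ∑ i ∈ s, w i * η ^ ((j : ℤ) * e i) =
      d * ∑ i ∈ s with (d : ℤ) ∣ e i - r, w i := by
    simp_rw [Finset.mul_sum]
    rw [Finset.sum_comm, Finset.sum_filter]
    refine Finset.sum_congr rfl fun i _ => ?_
    have h3 : ∀ j : ℕ, η ^ (-(j : ℤ) * r) * (w i * η ^ ((j : ℤ) * e i)) =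
        w i * (η ^ (e i - r)) ^ j := by
      intro j
      rw [← zpow_natCast, ← zpow_mul, show (e i - r) * (j : ℤ) = -(j : ℤ) * r + j * e i by ring,
        zpow_add₀ hη0]
      ring
    simp_rw [h3]
    rw [← Finset.mul_sum]
    split_ifs with hdv
    · rw [(hη.zpow_eq_one_iff_dvd _).2 hdv]
      simp [mul_comm]
    · have hne : η ^ (e i - r) ≠ 1 := fun hh => hdv ((hη.zpow_eq_one_iff_dvd _).1 hh)
      rw [geom_sum_eq hne, ← zpow_natCast, ← zpow_mul, mul_comm (e i - r), zpow_mul, zpow_natCast,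
        hη.pow_eq_one, one_zpow]
      simp
  rw [h1] at h2
  field_simp
  rw [mul_comm _ (d : ℂ), ← h2]
  ring

/-- If every prime factor of `d` divides `N / d`, the class sums modulo `d` of a vanishing sum
vanish separately. -/
theorem class_sums_eq_zero {ι : Type*} {N M d : ℕ} (hN : 0 < N) (hNd : N = M * d)
    (hdM : ∀ q : ℕ, q.Prime → q ∣ d → q ∣ M) {ζ : ℂ} (hζ : IsPrimitiveRoot ζ N)
    (s : Finset ι) (e : ι → ℤ) (h : ∑ i ∈ s, ζ ^ e i = 0) (r : ℤ) :
    ∑ i ∈ s with (d : ℤ) ∣ e i - r, ζ ^ e i = 0 := by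
  have hd : 0 < d := Nat.pos_of_ne_zero (by rintro rfl; simp at hNd; omega)
  have hη : IsPrimitiveRoot (ζ ^ M) d := hζ.pow hN hNd
  have hz0 := hζ.ne_zero hN.ne'
  -- Twisting by `(ζ ^ M) ^ j` replaces `ζ` by `ζ ^ (1 + j * M)`. As every prime factor of `N`
  -- divides `M`, this is a conjugate of `ζ`, so every twisted sum vanishes.
  have ht : ∀ j : ℕ, ∑ i ∈ s, ζ ^ e i * (ζ ^ M) ^ ((j : ℤ) * e i) = 0 := by
    intro j
    have hc : Nat.Coprime (1 + j * M) N := by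
      refine Nat.Coprime.symm (Nat.coprime_of_dvd fun q hq hqN hq1 => ?_)
      have hqM : q ∣ M := by
        rw [hNd] at hqN
        rcases hq.dvd_mul.1 hqN with h | h
        · exact h
        · exact hdM q hq h
      have := (Nat.dvd_add_left (hqM.mul_left j)).1 hq1
      exact hq.one_lt.ne' (Nat.dvd_one.1 this)
    have := sum_zpow_transfer hN hζ (hζ.pow_of_coprime _ hc) s e h
    rw [← this]
    refine Finset.sum_congr rfl fun i _ => ?_
    rw [← zpow_natCast, ← zpow_natCast, ← zpow_mul, ← zpow_mul, ← zpow_add₀ hz0]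
    congr 1
    push_cast
    ring
  obtain ⟨c, hc, hs⟩ := class_sums_of_twists s e (fun i => ζ ^ e i) hd hη 0 hd
    (fun j _ _ => ht j)
  rcases hc with hc | hc
  · rw [hs r, hc, zero_mul]
  · exact absurd (ht 0) hc

/-- If the prime `p` divides the order exactly once, the class sums modulo `p` of a vanishing sum
form a geometric progression. -/
theorem class_sums_geometric {ι : Type*} {N M p : ℕ} (hp : p.Prime) (hN : 0 < N)
    (hNp : N = M * p) (hpM : ¬ p ∣ M) {ζ : ℂ} (hζ : IsPrimitiveRoot ζ N)
    (s : Finset ι) (e : ι → ℤ) (h : ∑ i ∈ s, ζ ^ e i = 0) :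
    ∃ c θ : ℂ, θ ^ p = 1 ∧ ∀ r : ℤ,
      ∑ i ∈ s with (p : ℤ) ∣ e i - r, ζ ^ e i = c * θ ^ r := by
  have hη : IsPrimitiveRoot (ζ ^ M) p := hζ.pow hN hNp
  have hz0 := hζ.ne_zero hN.ne'
  -- Because `p ∤ M`, at most one `j` below `p` makes `1 + j * M` divisible by `p`; all other twists
  -- are conjugates of `ζ`.
  obtain ⟨j₀, hj₀, huniq⟩ : ∃ j₀ < p, ∀ j < p, j ≠ j₀ → ¬ p ∣ 1 + j * M := by
    by_cases hex : ∃ j₀ < p, p ∣ 1 + j₀ * M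
    · obtain ⟨j₀, hj₀, hd⟩ := hex
      refine ⟨j₀, hj₀, fun j hj hne hdj => hne ?_⟩
      have h1 : (p : ℤ) ∣ ((j : ℤ) - j₀) * M := by
        have := dvd_sub (Int.natCast_dvd_natCast.2 hdj) (Int.natCast_dvd_natCast.2 hd)
        push_cast at this
        rwa [show ((j : ℤ) - j₀) * M = 1 + j * M - (1 + j₀ * M) by ring]
      rcases (Nat.prime_iff_prime_int.1 hp).dvd_or_dvd h1 with h2 | h2
      · have := Int.eq_zero_of_abs_lt_dvd h2 (by rw [abs_lt]; omega)
        omega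
      · exact absurd (Int.natCast_dvd_natCast.1 h2) hpM
    · push Not at hex
      exact ⟨0, hp.pos, fun j hj _ => hex j hj⟩
  have ht : ∀ j < p, j ≠ j₀ → ∑ i ∈ s, ζ ^ e i * (ζ ^ M) ^ ((j : ℤ) * e i) = 0 := by
    intro j hj hne
    have hc : Nat.Coprime (1 + j * M) N := by
      refine Nat.Coprime.symm (Nat.coprime_of_dvd fun q hq hqN hq1 => ?_)
      rw [hNp] at hqN
      rcases hq.dvd_mul.1 hqN with h | h
      · have := (Nat.dvd_add_left (h.mul_left j)).1 hq1
        exact hq.one_lt.ne' (Nat.dvd_one.1 this)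
      · rw [(Nat.prime_dvd_prime_iff_eq hq hp).1 h] at hq1
        exact huniq j hj hne hq1
    have := sum_zpow_transfer hN hζ (hζ.pow_of_coprime _ hc) s e h
    rw [← this]
    refine Finset.sum_congr rfl fun i _ => ?_
    rw [← zpow_natCast, ← zpow_natCast, ← zpow_mul, ← zpow_mul, ← zpow_add₀ hz0]
    congr 1
    push_cast
    ring
  obtain ⟨c, -, hs⟩ := class_sums_of_twists s e (fun i => ζ ^ e i) hp.pos hη j₀ hj₀ ht
  refine ⟨c, ((ζ ^ M) ^ (-(j₀ : ℤ))), ?_, fun r => ?_⟩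
  · rw [← zpow_natCast, ← zpow_mul, mul_comm, zpow_mul, zpow_natCast, hη.pow_eq_one, one_zpow]
  · rw [hs r, ← zpow_mul]

/-! ### Vanishing sums of four cosines -/

/-- Either two of the four numbers `x + x⁻¹` cancel, or one of them is zero and the three other
`x`, up to inversion, add up to zero. -/
def CosRelation (x : Fin 4 → ℂ) : Prop :=
  (∃ m m', m ≠ m' ∧ (x m + (x m)⁻¹) + (x m' + (x m')⁻¹) = 0) ∨
  ∃ m, x m + (x m)⁻¹ = 0 ∧ ∃ y : Fin 4 → ℂ, (∀ n, y n = x n ∨ y n = (x n)⁻¹) ∧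
    ∑ n ∈ Finset.univ.erase m, y n = 0

theorem CosRelation.of_inv {x y : Fin 4 → ℂ} (h : ∀ n, y n = x n ∨ y n = (x n)⁻¹)
    (hy : CosRelation y) : CosRelation x := by
  have hc : ∀ n, y n + (y n)⁻¹ = x n + (x n)⁻¹ := by
    intro n
    rcases h n with h | h <;> rw [h]
    rw [inv_inv, add_comm]
  rcases hy with ⟨m, m', hne, h1⟩ | ⟨m, h1, z, hz, h2⟩
  · exact Or.inl ⟨m, m', hne, by rw [← hc, ← hc]; exact h1⟩
  · refine Or.inr ⟨m, by rw [← hc]; exact h1, z, fun n => ?_, h2⟩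
    rcases h n with h | h <;> rcases hz n with h' | h' <;> simp [h', h]

/-- Complex conjugation is inversion on the unit circle. -/
theorem sum_inv_eq_zero {y : Fin 4 → ℂ} (hy : ∀ n, ‖y n‖ = 1) (I : Finset (Fin 4))
    (h : ∑ n ∈ I, y n = 0) : ∑ n ∈ I, (y n)⁻¹ = 0 := by
  have := congrArg (starRingEnd ℂ) h
  rw [map_sum, map_zero] at this
  rw [← this]
  refine Finset.sum_congr rfl fun n _ => ?_
  rw [Complex.inv_def, Complex.normSq_eq_norm_sq, hy n]
  simp

/-- The subsum vanishes together with its conjugate. With two terms this is a cancelling pair of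
cosines; with three, the fourth cosine must vanish; one term is impossible. With all four terms the
first and third elementary symmetric functions are zero, which forces two of the roots to be
opposite. -/
theorem cosRelation_of_subsum {y : Fin 4 → ℂ} (hy : ∀ n, ‖y n‖ = 1) {I : Finset (Fin 4)}
    (hI : I.Nonempty) (hs : ∑ n ∈ I, y n = 0) (ht : ∑ n, (y n + (y n)⁻¹) = 0) :
    CosRelation y := by
  have h0 : ∀ n, y n ≠ 0 := fun n hn => by have := hy n; rw [hn] at this; simp at this
  have hs' := sum_inv_eq_zero hy I hs
  have hsum : ∀ f : Fin 4 → ℂ, ∑ n ∈ I, f n =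
      (if 0 ∈ I then f 0 else 0) + (if 1 ∈ I then f 1 else 0) + (if 2 ∈ I then f 2 else 0) +
        (if 3 ∈ I then f 3 else 0) := by
    intro f
    rw [← Fin.sum_univ_four fun n => if n ∈ I then f n else 0]
    simp
  rw [hsum] at hs hs'
  rw [Fin.sum_univ_four] at ht
  have triple : ∀ m : Fin 4, y m + (y m)⁻¹ = 0 → ∑ n ∈ Finset.univ.erase m, y n = 0 →
      CosRelation y := fun m h1 h2 => Or.inr ⟨m, h1, y, fun _ => Or.inl rfl, h2⟩
  have pair : ∀ m m' : Fin 4, m ≠ m' → (y m + (y m)⁻¹) + (y m' + (y m')⁻¹) = 0 →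
      CosRelation y := fun m m' h1 h2 => Or.inl ⟨m, m', h1, h2⟩
  have he : ∀ m, ∑ n ∈ Finset.univ.erase m, y n = ∑ n, y n - y m := fun m => by
    rw [← Finset.sum_erase_add _ _ (Finset.mem_univ m)]; ring
  by_cases i0 : 0 ∈ I <;> by_cases i1 : 1 ∈ I <;> by_cases i2 : 2 ∈ I <;> by_cases i3 : 3 ∈ I <;>
    simp only [i0, i1, i2, i3, if_true, if_false, add_zero, zero_add] at hs hs'
  -- The product equals `(y 0) ^ 2 * e₁ + e₃`, where `e₁` and `e₃` are elementary symmetric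
  -- functions of the four values.
  · have key : (y 0 + y 1) * (y 0 + y 2) * (y 0 + y 3) = 0 := by
      have e3 : y 1 * y 2 * y 3 + y 0 * y 2 * y 3 + y 0 * y 1 * y 3 + y 0 * y 1 * y 2 = 0 := by
        have h0 := h0 0; have h1 := ‹∀ n, y n ≠ 0› 1; have h2 := ‹∀ n, y n ≠ 0› 2
        have h3 := ‹∀ n, y n ≠ 0› 3
        field_simp at hs'
        linear_combination hs'
      linear_combination (y 0) ^ 2 * hs + e3
    have cancel : ∀ n, y 0 + y n = 0 → (y 0 + (y 0)⁻¹) + (y n + (y n)⁻¹) = 0 := by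
      intro n hn
      rw [eq_neg_of_add_eq_zero_right hn, inv_neg]
      ring
    rcases mul_eq_zero.1 key with h | h
    · rcases mul_eq_zero.1 h with h | h
      · exact pair 0 1 (by decide) (cancel 1 h)
      · exact pair 0 2 (by decide) (cancel 2 h)
    · exact pair 0 3 (by decide) (cancel 3 h)
  · exact triple 3 (by linear_combination ht - hs - hs')
      (by rw [he, Fin.sum_univ_four]; linear_combination hs)
  · exact triple 2 (by linear_combination ht - hs - hs')
      (by rw [he, Fin.sum_univ_four]; linear_combination hs)
  · exact pair 0 1 (by decide) (by linear_combination hs + hs')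
  · exact triple 1 (by linear_combination ht - hs - hs')
      (by rw [he, Fin.sum_univ_four]; linear_combination hs)
  · exact pair 0 2 (by decide) (by linear_combination hs + hs')
  · exact pair 0 3 (by decide) (by linear_combination hs + hs')
  · exact absurd hs (h0 0)
  · exact triple 0 (by linear_combination ht - hs - hs')
      (by rw [he, Fin.sum_univ_four]; linear_combination hs)
  · exact pair 1 2 (by decide) (by linear_combination hs + hs')
  · exact pair 1 3 (by decide) (by linear_combination hs + hs')
  · exact absurd hs (h0 1)
  · exact pair 2 3 (by decide) (by linear_combination hs + hs')
  · exact absurd hs (h0 2)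
  · exact absurd hs (h0 3)
  · obtain ⟨n, hn⟩ := hI
    fin_cases n <;> contradiction

/-- The exponents `e` together with their negatives. -/
def withNeg (e : Fin 4 → ℤ) : Fin 4 ⊕ Fin 4 → ℤ := Sum.elim e fun n => -e n

theorem sum_filter_withNeg (ζ : ℂ) (e : Fin 4 → ℤ) (P : ℤ → Prop) [DecidablePred P] :
    ∑ i with P (withNeg e i), ζ ^ withNeg e i =
      ∑ n, ((if P (e n) then ζ ^ e n else 0) + if P (-e n) then ζ ^ (-e n) else 0) := by
  rw [Finset.sum_filter, Fintype.sum_sum_type, Finset.sum_add_distrib]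
  rfl

theorem sum_withNeg (ζ : ℂ) (e : Fin 4 → ℤ) :
    ∑ i, ζ ^ withNeg e i = ∑ n, (ζ ^ e n + (ζ ^ e n)⁻¹) := by
  rw [Fintype.sum_sum_type, Finset.sum_add_distrib]
  simp [withNeg]

/-- Since `d ∤ 2r`, the classes of `r` and `-r` are different, so at most one of `e n`, `-e n` lies
in the class of `r`. Choosing that representative turns the class sum into a subsum of four terms,
nonempty because of `m`. -/
theorem cosRelation_of_class {N : ℕ} (hN : 0 < N) {ζ : ℂ} (hζ : IsPrimitiveRoot ζ N)
    {e : Fin 4 → ℤ} (h : ∑ n, (ζ ^ e n + (ζ ^ e n)⁻¹) = 0) {d r : ℤ} (hr : ¬ d ∣ 2 * r)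
    {m : Fin 4} (hm : d ∣ e m - r)
    (hs : ∑ i with d ∣ withNeg e i - r, ζ ^ withNeg e i = 0) :
    CosRelation fun n => ζ ^ e n := by
  have hz : ‖ζ‖ = 1 := Complex.norm_eq_one_of_pow_eq_one hζ.pow_eq_one hN.ne'
  let f : Fin 4 → ℤ := fun n => if d ∣ -e n - r then -e n else e n
  have hf : ∀ n, ζ ^ f n = ζ ^ e n ∨ ζ ^ f n = (ζ ^ e n)⁻¹ := by
    intro n
    simp only [f]
    split_ifs
    · right; rw [zpow_neg]
    · left; rfl
  have hexcl : ∀ a : ℤ, d ∣ a - r → ¬ d ∣ -a - r := by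
    intro a h1 h2
    apply hr
    have := dvd_neg.2 (dvd_add h1 h2)
    rwa [show -(a - r + (-a - r)) = 2 * r by ring] at this
  refine CosRelation.of_inv hf (cosRelation_of_subsum
    (I := Finset.univ.filter fun n => d ∣ e n - r ∨ d ∣ -e n - r)
    (fun n => by rw [norm_zpow, hz, one_zpow]) ⟨m, by simp [hm]⟩ ?_ ?_)
  · rw [sum_filter_withNeg ζ e fun a => d ∣ a - r] at hs
    rw [Finset.sum_filter]
    refine Eq.trans (Finset.sum_congr rfl fun n _ => ?_) hs
    simp only [f]
    by_cases h1 : d ∣ e n - r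
    · simp [h1, hexcl _ h1]
    · by_cases h2 : d ∣ -e n - r <;> simp [h1, h2]
  · rw [← h]
    refine Finset.sum_congr rfl fun n _ => ?_
    rcases hf n with h | h <;> rw [h]
    rw [inv_inv, add_comm]

/-- The six nonzero classes use up three pairs `±a` and the class 0 needs the fourth, so no two of
the four residues agree up to sign. -/
theorem injective_of_hits_all_mod_seven : ∀ a b c d : ZMod 7,
    (∀ r, r = a ∨ r = b ∨ r = c ∨ r = d ∨ r = -a ∨ r = -b ∨ r = -c ∨ r = -d) →
    a ^ 2 ≠ b ^ 2 ∧ a ^ 2 ≠ c ^ 2 ∧ a ^ 2 ≠ d ^ 2 ∧ b ^ 2 ≠ c ^ 2 ∧ b ^ 2 ≠ d ^ 2 ∧ c ^ 2 ≠ d ^ 2 := by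
  decide +kernel

/-- If the order is `7` times a number prime to `7` and every residue class mod `7` is hit by one
of the eight exponents, the four roots of unity have order dividing `42`. -/
theorem pow_eq_one_of_hits_all_mod_seven {ζ : ℂ} (hζ : ‖ζ‖ = 1) {e : Fin 4 → ℤ} {c θ : ℂ}
    (hθ : θ ^ 7 = 1)
    (hs : ∀ r : ℤ, ∑ i with (7 : ℤ) ∣ withNeg e i - r, ζ ^ withNeg e i = c * θ ^ r)
    (hall : ∀ r : ℤ, ∃ n, (7 : ℤ) ∣ e n - r ∨ (7 : ℤ) ∣ -e n - r) (n : Fin 4) :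
    (ζ ^ e n) ^ 42 = 1 := by
  have hz0 : ζ ≠ 0 := fun h => by rw [h] at hζ; simp at hζ
  have hθ0 : θ ≠ 0 := fun h => by rw [h] at hθ; simp at hθ
  have hcast : ∀ a b : ℤ, (7 : ℤ) ∣ a - b ↔ (b : ZMod 7) = a := fun a b => by
    rw [ZMod.intCast_eq_intCast_iff_dvd_sub]; rfl
  have hinj : ∀ n m : Fin 4, n ≠ m → ((e n : ℤ) : ZMod 7) ^ 2 ≠ ((e m : ℤ) : ZMod 7) ^ 2 := by
    have := injective_of_hits_all_mod_seven (e 0) (e 1) (e 2) (e 3) (fun r => by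
      obtain ⟨n, hn⟩ := hall r.val
      rw [hcast, hcast] at hn
      push_cast at hn
      rw [ZMod.natCast_zmod_val] at hn
      fin_cases n <;> simp at hn <;> tauto)
    obtain ⟨h1, h2, h3, h4, h5, h6⟩ := this
    intro n m hnm
    fin_cases n <;> fin_cases m <;>
      first
        | exact absurd rfl hnm
        | assumption
        | exact Ne.symm (by assumption)
  have hne : ∀ n m, m ≠ n → ¬ (7 : ℤ) ∣ e m - e n ∧ ¬ (7 : ℤ) ∣ -e m - e n := by
    intro n m hnm
    rw [hcast, hcast]
    refine ⟨fun h => hinj m n hnm (by rw [h]), fun h => hinj m n hnm ?_⟩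
    push_cast at h
    rw [h, neg_sq]
  -- A nonzero class contains exactly one of the eight exponents, so its class sum is a single root
  -- of unity.
  have hval : ∀ n, ¬ (7 : ℤ) ∣ e n → ζ ^ e n = c * θ ^ e n := by
    intro n hn
    rw [← hs, sum_filter_withNeg ζ e fun a => (7 : ℤ) ∣ a - e n, Finset.sum_eq_single n]
    · rw [if_pos (by simp), if_neg (by omega), add_zero]
    · intro m _ hm
      rw [if_neg (hne n m hm).1, if_neg (hne n m hm).2, add_zero]
    · simp
  have hval' : ∀ n, ¬ (7 : ℤ) ∣ e n → (ζ ^ e n)⁻¹ = c * (θ ^ e n)⁻¹ := by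
    intro n hn
    rw [← zpow_neg, ← zpow_neg, ← hs, sum_filter_withNeg ζ e fun a => (7 : ℤ) ∣ a - -e n,
      Finset.sum_eq_single n]
    · rw [if_neg (by omega), if_pos (by simp), zero_add]
    · intro m _ hm
      rw [if_neg (by have := (hne n m hm).2; omega), if_neg (by have := (hne n m hm).1; omega),
        add_zero]
    · simp
  obtain ⟨m, hm⟩ := hall 1
  have hm7 : ¬ (7 : ℤ) ∣ e m := by omega
  -- The classes of `e m` and `-e m` give `c * θ ^ e m` and `c * (θ ^ e m)⁻¹`, whose product must be
  -- 1.
  have hc : c ^ 2 = 1 := by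
    have h1 : ζ ^ e m * (ζ ^ e m)⁻¹ = 1 := mul_inv_cancel₀ (zpow_ne_zero _ hz0)
    rw [hval' m hm7, hval m hm7] at h1
    have h2 : θ ^ e m ≠ 0 := zpow_ne_zero _ hθ0
    field_simp at h1
    exact h1
  by_cases hn : (7 : ℤ) ∣ e n
  -- The class 0 contains precisely `e n` and `-e n`. With `c = ±1`, the equation `x + x⁻¹ = c`
  -- makes `x` a sixth root of unity.
  · have h0 : ζ ^ e n + (ζ ^ e n)⁻¹ = c := by
      have h1 := hs 0
      rw [zpow_zero, mul_one, sum_filter_withNeg ζ e fun a => (7 : ℤ) ∣ a - 0,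
        Finset.sum_eq_single n] at h1
      · rwa [if_pos (by simpa using hn), if_pos (by simpa using hn), zpow_neg] at h1
      · intro m _ hm
        rw [if_neg (by have := (hne n m hm).1; omega), if_neg (by have := (hne n m hm).1; omega),
          add_zero]
      · simp
    have hx : ζ ^ e n ≠ 0 := zpow_ne_zero _ hz0
    generalize ζ ^ e n = x at h0 hx
    have h1 : x ^ 2 + 1 = c * x := by
      field_simp at h0; linear_combination h0
    have h2 : x ^ 6 = 1 := by
      linear_combination (x ^ 4 + c * x ^ 3 - c * x - 1) * h1 + (x ^ 4 - x ^ 2) * hc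
    rw [show (42 : ℕ) = 6 * 7 by norm_num, pow_mul, h2, one_pow]
  · have h1 : (θ ^ e n) ^ 7 = 1 := by
      rw [← zpow_natCast, ← zpow_mul, mul_comm, zpow_mul, zpow_natCast, hθ, one_zpow]
    rw [hval n hn, show (c * θ ^ e n) ^ 42 = (c ^ 2) ^ 21 * ((θ ^ e n) ^ 7) ^ 6 by ring, hc, h1]
    simp

theorem dvd_sixty_of_no_bad_prime {N : ℕ} (h8 : ¬ 8 ∣ N)
    (hodd : ∀ p, p.Prime → p ≠ 2 → ¬ p ^ 2 ∣ N) (h7 : ∀ p, p.Prime → 7 ≤ p → ¬ p ∣ N) :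
    N ∣ 60 := by
  rw [Nat.dvd_iff_prime_pow_dvd_dvd]
  intro p k hp hk
  rcases Nat.eq_zero_or_pos k with rfl | hk0
  · simp
  have hpN : p ∣ N := (dvd_pow_self p hk0.ne').trans hk
  have hp7 : p < 7 := by
    by_contra hh
    exact h7 p hp (by omega) hpN
  by_cases hp2 : p = 2
  · subst hp2
    have : k ≤ 2 := by
      by_contra hh
      exact h8 ((pow_dvd_pow 2 (show 3 ≤ k by omega)).trans hk)
    interval_cases k <;> norm_num
  · have : k = 1 := by
      by_contra hh
      exact hodd p hp hp2 ((pow_dvd_pow p (show 2 ≤ k by omega)).trans hk)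
    subst this
    interval_cases p <;> first | (exfalso; revert hp; norm_num; done) | norm_num

/-- Classification of vanishing sums of four cosines of rational angles. -/
theorem cosRelation_or_small_order (N : ℕ) (hN : 0 < N) {ζ : ℂ} (hζ : IsPrimitiveRoot ζ N)
    (e : Fin 4 → ℤ) (h : ∑ n, (ζ ^ e n + (ζ ^ e n)⁻¹) = 0) :
    CosRelation (fun n => ζ ^ e n) ∨ (∀ n, (ζ ^ e n) ^ 60 = 1) ∨ ∀ n, (ζ ^ e n) ^ 42 = 1 := by
  induction N using Nat.strong_induction_on generalizing ζ e with
  | _ N ih =>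
  have hz : ‖ζ‖ = 1 := Complex.norm_eq_one_of_pow_eq_one hζ.pow_eq_one hN.ne'
  have hw := h
  rw [← sum_withNeg] at hw
  -- If `p` divides all exponents, `ζ` can be replaced by `ζ ^ p`, of smaller order.
  have reduce : ∀ p : ℕ, p.Prime → p ∣ N → (∀ n, (p : ℤ) ∣ e n) →
      CosRelation (fun n => ζ ^ e n) ∨ (∀ n, (ζ ^ e n) ^ 60 = 1) ∨ ∀ n, (ζ ^ e n) ^ 42 = 1 := by
    rintro p hp ⟨M, rfl⟩ hpe
    choose f hf using hpe
    have hM : 0 < M := Nat.pos_of_mul_pos_left hN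
    have hx : ∀ n, ζ ^ e n = (ζ ^ p) ^ f n := fun n => by
      rw [hf, zpow_mul, zpow_natCast]
    simp_rw [hx] at h ⊢
    exact ih M (lt_mul_of_one_lt_left hM hp.one_lt) hM (hζ.pow hN rfl) f h
  by_cases h8 : 8 ∣ N
  · by_cases hall : ∀ n, ((2 : ℕ) : ℤ) ∣ e n
    · exact reduce 2 Nat.prime_two (by omega) hall
    · push Not at hall
      obtain ⟨m, hm⟩ := hall
      left
      obtain ⟨M, rfl⟩ := h8
      -- Modulus 4 instead of 2, because an odd class must differ from its negative; this is why `8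
      -- ∣ N` is needed.
      refine cosRelation_of_class hN hζ h (d := 4) (r := e m) (by omega) (m := m) (by simp) ?_
      exact class_sums_eq_zero hN (M := 2 * M) (d := 4) (by ring) (fun q hq hq4 => by
        have : q ∣ 2 := hq.dvd_of_dvd_pow (show q ∣ 2 ^ 2 from hq4)
        exact this.mul_right M) hζ _ _ hw _
  by_cases hsq : ∃ p : ℕ, p.Prime ∧ p ≠ 2 ∧ p ^ 2 ∣ N
  · obtain ⟨p, hp, hp2, hpN⟩ := hsq
    by_cases hall : ∀ n, (p : ℤ) ∣ e n
    · exact reduce p hp ((dvd_pow_self p two_ne_zero).trans hpN) hall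
    · push Not at hall
      obtain ⟨m, hm⟩ := hall
      left
      obtain ⟨M, rfl⟩ := hpN
      refine cosRelation_of_class hN hζ h (d := p) (r := e m) (fun hd => ?_) (m := m) (by simp) ?_
      · rcases (Nat.prime_iff_prime_int.1 hp).dvd_or_dvd hd with h2 | h2
        · exact hp2 ((Nat.prime_dvd_prime_iff_eq hp Nat.prime_two).1 (by exact_mod_cast h2))
        · exact hm h2
      · exact class_sums_eq_zero hN (M := p * M) (d := p) (by ring)
          (fun q hq hqp => hqp.mul_right M) hζ _ _ hw _
  by_cases hbig : ∃ p : ℕ, p.Prime ∧ 7 ≤ p ∧ p ∣ N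
  · obtain ⟨p, hp, hp7, hpN⟩ := hbig
    by_cases hall : ∀ n, (p : ℤ) ∣ e n
    · exact reduce p hp hpN hall
    push Not at hall
    obtain ⟨m, hm⟩ := hall
    obtain ⟨M, hM⟩ := hpN
    have hpM : ¬ p ∣ M := fun hd => hsq ⟨p, hp, by omega, by
      rw [hM, sq]; exact mul_dvd_mul_left p hd⟩
    obtain ⟨c, θ, hθ, hs⟩ := class_sums_geometric hp hN (by rw [hM, mul_comm]) hpM hζ _ _ hw
    by_cases hhit : ∀ r : ℤ, ∃ n, (p : ℤ) ∣ e n - r ∨ (p : ℤ) ∣ -e n - r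
    -- Eight exponents cover all `p` classes.
    · have hp8 : p ≤ 8 := by
        have hsurj : Function.Surjective fun i => ((withNeg e i : ℤ) : ZMod p) := by
          intro r
          obtain ⟨r, rfl⟩ := ZMod.intCast_surjective r
          obtain ⟨n, hn | hn⟩ := hhit r
          · exact ⟨Sum.inl n, ((ZMod.intCast_eq_intCast_iff_dvd_sub _ _ _).2 hn).symm⟩
          · exact ⟨Sum.inr n, ((ZMod.intCast_eq_intCast_iff_dvd_sub _ _ _).2 hn).symm⟩
        have : NeZero p := ⟨hp.ne_zero⟩
        have := Fintype.card_le_of_surjective _ hsurj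
        simpa [ZMod.card] using this
      have hp7' : p = 7 := by
        by_contra hne
        have : p = 8 := by omega
        rw [this] at hp
        revert hp; norm_num
      subst hp7'
      exact Or.inr (Or.inr (pow_eq_one_of_hits_all_mod_seven hz hθ hs hhit))
    · left
      push Not at hhit
      obtain ⟨r, hr⟩ := hhit
      have hθ0 : θ ≠ 0 := fun h => by rw [h, zero_pow hp.ne_zero] at hθ; simp at hθ
      -- An empty class has sum 0, which kills the whole geometric progression.
      have hc : c = 0 := by
        have h1 := hs r
        rw [sum_filter_withNeg ζ e fun a => (p : ℤ) ∣ a - r] at h1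
        simp only [(hr _).1, (hr _).2, if_false, add_zero, Finset.sum_const_zero] at h1
        exact (mul_eq_zero.1 h1.symm).resolve_right (zpow_ne_zero _ hθ0)
      refine cosRelation_of_class hN hζ h (d := p) (r := e m) (fun hd => ?_) (m := m) (by simp) ?_
      · rcases (Nat.prime_iff_prime_int.1 hp).dvd_or_dvd hd with h2 | h2
        · have := (Nat.prime_dvd_prime_iff_eq hp Nat.prime_two).1 (by exact_mod_cast h2)
          omega
        · exact hm h2
      · rw [hs, hc, zero_mul]
  · push Not at hsq hbig
    obtain ⟨L, hL⟩ := dvd_sixty_of_no_bad_prime h8 hsq hbig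
    refine Or.inr (Or.inl fun n => ?_)
    rw [← zpow_natCast, ← zpow_mul, mul_comm, zpow_mul, zpow_natCast, hL, pow_mul, hζ.pow_eq_one,
      one_pow, one_zpow]

/-! ### The sine relation and the one-parameter family -/

/-- The equation `sin (πi/k) sin (πt/k) = sin (πj/k) sin (πs/k)`. -/
def SinRelation (k i j s t : ℕ) : Prop :=
  Real.sin (Real.pi * i / k) * Real.sin (Real.pi * t / k) =
    Real.sin (Real.pi * j / k) * Real.sin (Real.pi * s / k)

/-- The angles, in units of `π / k`, whose cosines add up to zero if the sine relation holds. -/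
def cosAngles (k i j s t : ℕ) : Fin 4 → ℤ := ![i + t, k - (t - i), k - (j + s), s - j]

/-- The primitive root of unity `exp (πi/k)`. -/
noncomputable def halfPhi (k : ℕ) : ℂ :=
  Complex.exp (2 * (Real.pi : ℂ) * Complex.I / ((2 * k : ℕ) : ℂ))

theorem halfPhi_primitive {k : ℕ} (hk : 0 < k) : IsPrimitiveRoot (halfPhi k) (2 * k) :=
  Complex.isPrimitiveRoot_exp _ (by omega)

theorem halfPhi_zpow {k : ℕ} (hk : 0 < k) (a : ℤ) :
    halfPhi k ^ a + (halfPhi k ^ a)⁻¹ = ((2 * Real.cos (Real.pi * a / k) : ℝ) : ℂ) := by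
  have hk' : (k : ℂ) ≠ 0 := by exact_mod_cast hk.ne'
  rw [halfPhi, ← Complex.exp_int_mul, ← Complex.exp_neg]
  push_cast
  rw [Complex.two_cos]
  congr 2 <;> field_simp

theorem SinRelation.sum_cos {k i j s t : ℕ} (hk : 0 < k) (h : SinRelation k i j s t) :
    ∑ n, (halfPhi k ^ cosAngles k i j s t n + (halfPhi k ^ cosAngles k i j s t n)⁻¹) = 0 := by
  have hk' : (k : ℝ) ≠ 0 := by exact_mod_cast hk.ne'
  simp_rw [halfPhi_zpow hk]
  rw [← Complex.ofReal_sum, Fin.sum_univ_four, Complex.ofReal_eq_zero]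
  simp only [cosAngles, Matrix.cons_val]
  push_cast
  unfold SinRelation at h
  rw [show Real.pi * (i + t) / k = Real.pi * i / k + Real.pi * t / k by ring,
    show Real.pi * (k - (t - i)) / k = Real.pi - (Real.pi * t / k - Real.pi * i / k) by
      field_simp,
    show Real.pi * (k - (j + s)) / k = Real.pi - (Real.pi * j / k + Real.pi * s / k) by
      field_simp,
    show Real.pi * (s - j) / k = Real.pi * s / k - Real.pi * j / k by ring,
    Real.cos_pi_sub, Real.cos_pi_sub, Real.cos_add, Real.cos_add, Real.cos_sub, Real.cos_sub]
  linear_combination -4 * h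

theorem halfPhi_zpow_self {k : ℕ} (hk : 0 < k) : halfPhi k ^ (k : ℤ) = -1 := by
  have := (halfPhi_primitive hk).pow (by omega) (show 2 * k = k * 2 by ring)
  rw [zpow_natCast]
  exact this.eq_neg_one_of_two_right

/-- With `x`, `y` the two powers, the hypothesis factors as `(x + y) * (x * y + 1) = 0`; the range
of the angles leaves only supplementary ones. -/
theorem add_eq_of_cos_cancel {k : ℕ} (hk : 0 < k) {a b : ℤ} (ha : 0 ≤ a) (ha' : a ≤ k)
    (hb : 0 ≤ b) (hb' : b ≤ k)
    (h : (halfPhi k ^ a + (halfPhi k ^ a)⁻¹) + (halfPhi k ^ b + (halfPhi k ^ b)⁻¹) = 0) :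
    a + b = k := by
  have hz := halfPhi_primitive hk
  have h0 : halfPhi k ≠ 0 := hz.ne_zero (by omega)
  have hd : ((2 * k : ℕ) : ℤ) ∣ a - b - k ∨ ((2 * k : ℕ) : ℤ) ∣ a + b - k := by
    rw [← hz.zpow_eq_one_iff_dvd, ← hz.zpow_eq_one_iff_dvd, zpow_sub₀ h0, zpow_sub₀ h0,
      zpow_sub₀ h0, zpow_add₀ h0, halfPhi_zpow_self hk]
    have hx : halfPhi k ^ a ≠ 0 := zpow_ne_zero _ h0
    have hy : halfPhi k ^ b ≠ 0 := zpow_ne_zero _ h0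
    generalize halfPhi k ^ a = x at *
    generalize halfPhi k ^ b = y at *
    have : (x + y) * (x * y + 1) = 0 := by
      field_simp at h
      linear_combination h
    rcases mul_eq_zero.1 this with h | h
    · left
      rw [eq_neg_of_add_eq_zero_left h]
      field_simp
    · right
      rw [eq_neg_of_add_eq_zero_left h]
      norm_num
  push_cast at hd
  rcases hd with ⟨q, hq⟩ | ⟨q, hq⟩
  · have h1 : -2 < q := by by_contra hh; nlinarith
    have h2 : q < 1 := by by_contra hh; nlinarith
    interval_cases q <;> omega
  · have h1 : -1 < q ∨ q ≤ -1 := by omega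
    have h1 : -1 ≤ q := by by_contra hh; nlinarith
    have h2 : q < 1 := by by_contra hh; nlinarith
    interval_cases q <;> omega

/-- Three powers of `exp (πi/k)` adding up to zero differ by thirds of a full turn. -/
theorem thirds_of_sum_eq_zero {k : ℕ} (hk : 0 < k) {a b c : ℤ} (ha : |a| ≤ k) (hb : |b| ≤ k)
    (hc : |c| ≤ k) (h : halfPhi k ^ a + halfPhi k ^ b + halfPhi k ^ c = 0) :
    ∃ κ : ℤ, k = 3 * κ ∧
      ((b - a = 2 * κ ∨ b - a = -4 * κ) ∧ (c - a = -2 * κ ∨ c - a = 4 * κ) ∨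
        (c - a = 2 * κ ∨ c - a = -4 * κ) ∧ (b - a = -2 * κ ∨ b - a = 4 * κ)) := by
  have hz := halfPhi_primitive hk
  have h0 : halfPhi k ≠ 0 := hz.ne_zero (by omega)
  have hn : ‖halfPhi k‖ = 1 := Complex.norm_eq_one_of_pow_eq_one hz.pow_eq_one (by omega)
  have hinv : (halfPhi k ^ a)⁻¹ + (halfPhi k ^ b)⁻¹ + (halfPhi k ^ c)⁻¹ = 0 := by
    have := sum_inv_eq_zero (y := fun n => halfPhi k ^ (![a, b, c, 0] n))
      (fun n => by rw [norm_zpow, hn, one_zpow]) {0, 1, 2} (by simpa [← add_assoc] using h)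
    simpa [← add_assoc] using this
  have hdvd : ∀ {u v w : ℤ}, halfPhi k ^ u + halfPhi k ^ v + halfPhi k ^ w = 0 →
      (halfPhi k ^ u)⁻¹ + (halfPhi k ^ v)⁻¹ + (halfPhi k ^ w)⁻¹ = 0 →
      ((2 * k : ℕ) : ℤ) ∣ 3 * (v - u) ∧ ¬ ((2 * k : ℕ) : ℤ) ∣ v - u := by
    intro u v w h hinv
    rw [← hz.zpow_eq_one_iff_dvd, ← hz.zpow_eq_one_iff_dvd, mul_comm, zpow_mul, zpow_sub₀ h0]
    have hx : halfPhi k ^ u ≠ 0 := zpow_ne_zero _ h0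
    have hy : halfPhi k ^ v ≠ 0 := zpow_ne_zero _ h0
    have hw : halfPhi k ^ w ≠ 0 := zpow_ne_zero _ h0
    generalize halfPhi k ^ u = x at *
    generalize halfPhi k ^ v = y at *
    generalize halfPhi k ^ w = z at *
    -- Eliminating `z` from the sum and the sum of inverses shows that `y / x` is a primitive cube
    -- root of unity.
    have hq : x ^ 2 + x * y + y ^ 2 = 0 := by
      field_simp at hinv
      linear_combination (x + y) * h - hinv
    constructor
    · rw [show (3 : ℤ) = ((3 : ℕ) : ℤ) by rfl, zpow_natCast, div_pow,
        div_eq_one_iff_eq (by positivity)]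
      linear_combination (y - x) * hq
    · intro hh
      rw [div_eq_one_iff_eq hx] at hh
      rw [hh] at hq
      have : 3 * x ^ 2 = 0 := by linear_combination hq
      exact hx (by simpa using this)
  obtain ⟨⟨q, hq⟩, hnq⟩ := hdvd h hinv
  obtain ⟨⟨q', hq'⟩, hnq'⟩ := hdvd (u := a) (v := c) (w := b) (by rw [← h]; ring)
    (by rw [← hinv]; ring)
  obtain ⟨-, hnq''⟩ := hdvd (u := b) (v := c) (w := a) (by rw [← h]; ring) (by rw [← hinv]; ring)
  rw [abs_le] at ha hb hc
  push_cast at *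
  have hbound : ∀ {x q : ℤ}, 3 * x = 2 * k * q → x ≤ 2 * k → -(2 * k) ≤ x → -3 ≤ q ∧ q ≤ 3 := by
    intro x q h1 h2 h3
    constructor <;> (by_contra hh; nlinarith)
  have hb1 := hbound hq (by omega) (by omega)
  have hb2 := hbound hq' (by omega) (by omega)
  have key : ∀ {x : ℤ}, (2 * (k : ℤ)) * 1 ≠ x ∧ (2 * (k : ℤ)) * -1 ≠ x ∧ (2 * (k : ℤ)) * 0 ≠ x ∨
      (2 * (k : ℤ)) ∣ x := by
    intro x
    by_cases hx : (2 * (k : ℤ)) ∣ x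
    · exact Or.inr hx
    · exact Or.inl ⟨fun h => hx ⟨_, h.symm⟩, fun h => hx ⟨_, h.symm⟩, fun h => hx ⟨_, h.symm⟩⟩
  have k1 := key.resolve_right hnq
  have k2 := key.resolve_right hnq'
  have k3 := key.resolve_right hnq''
  obtain ⟨hb1, hb1'⟩ := hb1
  obtain ⟨hb2, hb2'⟩ := hb2
  refine ⟨k / 3, ?_⟩
  interval_cases q <;> interval_cases q' <;> omega

/-- The three folded angles of three unit vectors adding up to zero. -/
theorem folded_thirds {k : ℕ} (hk : 0 < k) {a b c x y z : ℤ} (ha : 0 ≤ a ∧ a ≤ k)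
    (hb : 0 ≤ b ∧ b ≤ k) (hc : 0 ≤ c ∧ c ≤ k) (hx : x = a ∨ x = -a) (hy : y = b ∨ y = -b)
    (hz : z = c ∨ z = -c) (h : halfPhi k ^ x + halfPhi k ^ y + halfPhi k ^ z = 0) :
    ∃ κ : ℤ, k = 3 * κ ∧
      (a + b = 2 * κ ∧ (c = a + 2 * κ ∨ c = b + 2 * κ) ∨
        a + c = 2 * κ ∧ (b = a + 2 * κ ∨ b = c + 2 * κ) ∨
        b + c = 2 * κ ∧ (a = b + 2 * κ ∨ a = c + 2 * κ)) := by
  obtain ⟨κ, hκ, hd⟩ := thirds_of_sum_eq_zero hk (by rw [abs_le]; omega) (by rw [abs_le]; omega)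
    (by rw [abs_le]; omega) h
  refine ⟨κ, hκ, ?_⟩
  rcases hx with rfl | rfl <;> rcases hy with rfl | rfl <;> rcases hz with rfl | rfl <;>
    rcases hd with ⟨h1 | h1, h2 | h2⟩ | ⟨h1 | h1, h2 | h2⟩ <;> omega

/-- The normalized members of the one-parameter family. -/
def InParametricFamily (k i j s t : ℕ) : Prop :=
  (6 * j = k ∧ s = 2 * i ∧ t + i = 3 * j) ∨ (6 * s = k ∧ j = 2 * i ∧ t + i = 3 * s) ∨
    (6 * i = k ∧ t = 2 * j ∧ s + j = 3 * i)

/-- If a pair cancels, so does the complementary pair, and one of the two contains the index 0. -/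
theorem exists_cancel_with_zero {g : Fin 4 → ℂ} (hsum : g 0 + g 1 + g 2 + g 3 = 0) {n m : Fin 4}
    (hnm : n ≠ m) (h : g n + g m = 0) : ∃ q, q ≠ 0 ∧ g 0 + g q = 0 := by
  fin_cases n <;> fin_cases m <;> simp only [Fin.reduceFinMk, Fin.zero_eta, Fin.mk_one] at h <;>
    first
      | exact absurd rfl hnm
      | exact ⟨1, by decide, by linear_combination h⟩
      | exact ⟨2, by decide, by linear_combination h⟩
      | exact ⟨3, by decide, by linear_combination h⟩
      | exact ⟨1, by decide, by linear_combination hsum - h⟩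
      | exact ⟨2, by decide, by linear_combination hsum - h⟩
      | exact ⟨3, by decide, by linear_combination hsum - h⟩

instance (k i j s t : ℕ) : Decidable (InParametricFamily k i j s t) := by
  unfold InParametricFamily
  infer_instance

/-- Cancelling pairs give linear equations that contradict `0 < i < j ≤ s < t ≤ k/2`. In the other
case one angle is `π/2` and the three others, suitably signed, are spaced by thirds of a turn; the
linear systems compatible with the ordering are the family. -/
theorem parametric_of_cosRelation {k i j s t : ℕ} (hi : 0 < i) (hij : i < j) (hjs : j ≤ s)
    (hst : s < t) (htk : 2 * t ≤ k) (h : SinRelation k i j s t)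
    (hc : CosRelation fun n => halfPhi k ^ cosAngles k i j s t n) :
    InParametricFamily k i j s t := by
  have hk : 0 < k := by omega
  have hsum := h.sum_cos hk
  rw [Fin.sum_univ_four] at hsum
  have hr : ∀ n, 0 ≤ cosAngles k i j s t n ∧ cosAngles k i j s t n ≤ k := by
    intro n
    fin_cases n <;> simp [cosAngles] <;> omega
  have pair : ∀ n m : Fin 4, (halfPhi k ^ cosAngles k i j s t n +
      (halfPhi k ^ cosAngles k i j s t n)⁻¹) + (halfPhi k ^ cosAngles k i j s t m +
      (halfPhi k ^ cosAngles k i j s t m)⁻¹) = 0 →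
      cosAngles k i j s t n + cosAngles k i j s t m = k := fun n m h =>
    add_eq_of_cos_cancel hk (hr n).1 (hr n).2 (hr m).1 (hr m).2 h
  have triple : ∀ m n₁ n₂ n₃ : Fin 4, Finset.univ.erase m = {n₁, n₂, n₃} → n₁ ≠ n₂ → n₁ ≠ n₃ →
      n₂ ≠ n₃ → ∀ y : Fin 4 → ℂ, (∀ n, y n = halfPhi k ^ cosAngles k i j s t n ∨
        y n = (halfPhi k ^ cosAngles k i j s t n)⁻¹) → ∑ n ∈ Finset.univ.erase m, y n = 0 →
      ∃ x₁ x₂ x₃ : ℤ, (x₁ = cosAngles k i j s t n₁ ∨ x₁ = -cosAngles k i j s t n₁) ∧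
        (x₂ = cosAngles k i j s t n₂ ∨ x₂ = -cosAngles k i j s t n₂) ∧
        (x₃ = cosAngles k i j s t n₃ ∨ x₃ = -cosAngles k i j s t n₃) ∧
        halfPhi k ^ x₁ + halfPhi k ^ x₂ + halfPhi k ^ x₃ = 0 := by
    intro m n₁ n₂ n₃ he h12 h13 h23 y hy hs
    have hx : ∀ n, ∃ x : ℤ, (x = cosAngles k i j s t n ∨ x = -cosAngles k i j s t n) ∧
        y n = halfPhi k ^ x := by
      intro n
      rcases hy n with h | h
      · exact ⟨_, Or.inl rfl, h⟩
      · exact ⟨_, Or.inr rfl, by rw [h, zpow_neg]⟩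
    choose x hx hxy using hx
    refine ⟨x n₁, x n₂, x n₃, hx _, hx _, hx _, ?_⟩
    rw [he, Finset.sum_insert (by simp [h12, h13]), Finset.sum_insert (by simp [h23]),
      Finset.sum_singleton] at hs
    rw [← hxy, ← hxy, ← hxy, ← hs]
    ring
  rcases hc with ⟨n, m, hnm, hc⟩ | ⟨m, hm, y, hy, hs⟩
  · exfalso
    have first : ∀ n, n ≠ 0 → (halfPhi k ^ cosAngles k i j s t 0 +
      (halfPhi k ^ cosAngles k i j s t 0)⁻¹) + (halfPhi k ^ cosAngles k i j s t n +
      (halfPhi k ^ cosAngles k i j s t n)⁻¹) = 0 → False := by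
      intro n hn h
      have h1 := pair 0 n h
      fin_cases n
      · exact hn rfl
      · simp [cosAngles] at h1; omega
      · have h2 := pair 1 3 (by simp only [Fin.reduceFinMk] at h; linear_combination hsum - h)
        simp [cosAngles] at h1 h2; omega
      · have h2 := pair 1 2 (by simp only [Fin.reduceFinMk] at h; linear_combination hsum - h)
        simp [cosAngles] at h1 h2; omega
    obtain ⟨q, hq, hcq⟩ := exists_cancel_with_zero
      (g := fun n => halfPhi k ^ cosAngles k i j s t n + (halfPhi k ^ cosAngles k i j s t n)⁻¹)
      hsum hnm hc
    exact first q hq hcq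
  -- A vanishing cosine cancels with itself, so twice its angle is `k`.
  · have h2 := pair m m (by rw [hm, add_zero])
    unfold InParametricFamily
    fin_cases m
    · obtain ⟨x₁, x₂, x₃, e1, e2, e3, hx⟩ := triple 0 1 2 3 (by decide) (by decide) (by decide)
        (by decide) y hy hs
      obtain ⟨κ, hκ, hf⟩ := folded_thirds hk (hr 1) (hr 2) (hr 3) e1 e2 e3 hx
      simp [cosAngles] at hf h2
      rcases hf with ⟨h3, h4 | h4⟩ | ⟨h3, h4 | h4⟩ | ⟨h3, h4 | h4⟩ <;> omega
    · obtain ⟨x₁, x₂, x₃, e1, e2, e3, hx⟩ := triple 1 0 2 3 (by decide) (by decide) (by decide)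
        (by decide) y hy hs
      obtain ⟨κ, hκ, hf⟩ := folded_thirds hk (hr 0) (hr 2) (hr 3) e1 e2 e3 hx
      simp [cosAngles] at hf h2
      rcases hf with ⟨h3, h4 | h4⟩ | ⟨h3, h4 | h4⟩ | ⟨h3, h4 | h4⟩ <;> omega
    · obtain ⟨x₁, x₂, x₃, e1, e2, e3, hx⟩ := triple 2 0 1 3 (by decide) (by decide) (by decide)
        (by decide) y hy hs
      obtain ⟨κ, hκ, hf⟩ := folded_thirds hk (hr 0) (hr 1) (hr 3) e1 e2 e3 hx
      simp [cosAngles] at hf h2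
      rcases hf with ⟨h3, h4 | h4⟩ | ⟨h3, h4 | h4⟩ | ⟨h3, h4 | h4⟩ <;> omega
    · obtain ⟨x₁, x₂, x₃, e1, e2, e3, hx⟩ := triple 3 0 1 2 (by decide) (by decide) (by decide)
        (by decide) y hy hs
      obtain ⟨κ, hκ, hf⟩ := folded_thirds hk (hr 0) (hr 1) (hr 2) e1 e2 e3 hx
      simp [cosAngles] at hf h2
      rcases hf with ⟨h3, h4 | h4⟩ | ⟨h3, h4 | h4⟩ | ⟨h3, h4 | h4⟩ <;> omega

/-! ### Finite search modulo a prime -/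

/-- The test that every normalized solution of the sine relation modulo `p`, with sines taken from
the table `T`, passes the test `good`. -/
def sineTableCheck (p : ℕ) (T : List (ℕ × ℕ)) (good : ℕ → ℕ → ℕ → ℕ → Bool) : Bool :=
  T.all fun a => T.all fun b => Nat.ble b.1 a.1 || T.all fun c => !(Nat.ble b.1 c.1) ||
    T.all fun d => Nat.ble d.1 c.1 ||
      !(Nat.beq ((a.2 * d.2) % p) ((b.2 * c.2) % p)) || good a.1 b.1 c.1 d.1

/-- The vanishing cosine sum transfers from `halfPhi k` to `g` in `ZMod p`, where it becomes a
product relation between the values `g ^ x - g ^ (-x)` of the table. This is only a necessary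
condition, but every quadruple that passes it is checked to be `good`. -/
theorem good_of_sineTableCheck {k p g : ℕ} (hp : p.Prime) (hk : 0 < k) (T : List (ℕ × ℕ))
    (good : ℕ → ℕ → ℕ → ℕ → Bool) (hg : g ^ (2 * k) % p = 1)
    (hg' : ∀ l < 2 * k, 0 < l → g ^ l % p ≠ 1) (hT : T.map Prod.fst = List.range' 1 (k / 2))
    (hsin : ∀ a ∈ T, (a.2 + g ^ (2 * k - a.1)) % p = g ^ a.1 % p)
    (hcheck : sineTableCheck p T good = true) {i j s t : ℕ} (hi : 0 < i) (hij : i < j)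
    (hjs : j ≤ s) (hst : s < t) (htk : 2 * t ≤ k) (h : SinRelation k i j s t) :
    good i j s t = true := by
  have : Fact p.Prime := ⟨hp⟩
  have hcast : ∀ l : ℕ, g ^ l % p = 1 ↔ (g : ZMod p) ^ l = 1 := by
    intro l
    have := ZMod.natCast_eq_natCast_iff' (g ^ l) 1 p
    rw [Nat.mod_eq_of_lt hp.one_lt] at this
    rw [← this]
    push_cast
    rfl
  have hG : IsPrimitiveRoot (g : ZMod p) (2 * k) :=
    IsPrimitiveRoot.mk_of_lt _ (by omega) ((hcast _).1 hg) fun l hl hl' h1 =>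
      hg' l hl' hl ((hcast l).2 h1)
  have hG0 : (g : ZMod p) ≠ 0 := hG.ne_zero (by omega)
  have htab : ∀ x, 1 ≤ x → 2 * x ≤ k → ∃ v, (x, v) ∈ T ∧
      (v : ZMod p) = (g : ZMod p) ^ (x : ℤ) - ((g : ZMod p) ^ (x : ℤ))⁻¹ := by
    intro x hx hxk
    have hmem : x ∈ T.map Prod.fst := by
      rw [hT, List.mem_range'_1]
      omega
    obtain ⟨⟨x', v⟩, hv, rfl⟩ := List.mem_map.1 hmem
    refine ⟨v, hv, ?_⟩
    have h1 := (ZMod.natCast_eq_natCast_iff' _ _ _).2 (hsin _ hv)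
    push_cast at h1
    simp only at hx hxk ⊢
    rw [zpow_natCast]
    have h2 : (g : ZMod p) ^ (2 * k - x') = ((g : ZMod p) ^ x')⁻¹ := by
      rw [← mul_eq_one_iff_eq_inv₀ (pow_ne_zero _ hG0), ← pow_add,
        show 2 * k - x' + x' = 2 * k by omega, hG.pow_eq_one]
    rw [← h2]
    linear_combination h1
  have hneg : (g : ZMod p) ^ (k : ℤ) = -1 := by
    rw [zpow_natCast]
    exact (hG.pow (by omega) (show 2 * k = k * 2 by ring)).eq_neg_one_of_two_right
  have hsum := h.sum_cos hk
  rw [← sum_withNeg] at hsum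
  have hmod := sum_zpow_transfer (by omega) (halfPhi_primitive hk) hG _ _ hsum
  rw [Fintype.sum_sum_type, Fin.sum_univ_four, Fin.sum_univ_four] at hmod
  simp only [withNeg, Sum.elim_inl, Sum.elim_inr, cosAngles, Matrix.cons_val] at hmod
  simp only [zpow_neg, zpow_add₀ hG0, zpow_sub₀ hG0, hneg] at hmod
  obtain ⟨vi, hvi, ei⟩ := htab i (by omega) (by omega)
  obtain ⟨vj, hvj, ej⟩ := htab j (by omega) (by omega)
  obtain ⟨vs, hvs, es⟩ := htab s (by omega) (by omega)
  obtain ⟨vt, hvt, et⟩ := htab t (by omega) (by omega)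
  have heq : (vi * vt) % p = (vj * vs) % p := by
    rw [← ZMod.natCast_eq_natCast_iff']
    push_cast
    rw [ei, ej, es, et]
    have n1 : (g : ZMod p) ^ (i : ℤ) ≠ 0 := zpow_ne_zero _ hG0
    have n2 : (g : ZMod p) ^ (j : ℤ) ≠ 0 := zpow_ne_zero _ hG0
    have n3 : (g : ZMod p) ^ (s : ℤ) ≠ 0 := zpow_ne_zero _ hG0
    have n4 : (g : ZMod p) ^ (t : ℤ) ≠ 0 := zpow_ne_zero _ hG0
    generalize (g : ZMod p) ^ (i : ℤ) = x at *
    generalize (g : ZMod p) ^ (j : ℤ) = y at *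
    generalize (g : ZMod p) ^ (s : ℤ) = z at *
    generalize (g : ZMod p) ^ (t : ℤ) = w at *
    field_simp at hmod ⊢
    linear_combination hmod
  have h1 := List.all_eq_true.1 hcheck _ hvi
  have h2 := List.all_eq_true.1 h1 _ hvj
  rw [Bool.or_eq_true] at h2
  have h3 := List.all_eq_true.1 (h2.resolve_left (by simpa using hij)) _ hvs
  rw [Bool.or_eq_true] at h3
  have h4 := List.all_eq_true.1 (h3.resolve_left (by simpa using hjs)) _ hvt
  simpa [heq, hst.not_ge] using h4

/-- Values of `g ^ x - g ^ (-x)` modulo `6481` for `g = 129` of order `120`. -/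
def sineTableSixty : List (ℕ × ℕ) :=
  [(1, 1385), (2, 1026), (3, 2412), (4, 2670), (5, 2163), (6, 2966), (7, 5832), (8, 2585), (9,
   3804), (10, 729), (11, 4181), (12, 5452), (13, 1884), (14, 3529), (15, 267), (16, 169), (17,
   3700), (18, 3695), (19, 5799), (20, 161), (21, 703), (22, 4721), (23, 6112), (24, 2839), (25,
   2430), (26, 14), (27, 1235), (28, 1556), (29, 1504), (30, 1458)]

/-- The rows for 30, with entries doubled, followed by the rows for 60. -/
def sixtyRows : List (ℕ × ℕ × ℕ × ℕ) :=
  [(2, 6, 6, 22),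
   (6, 10, 10, 18),
   (14, 18, 18, 26),
   (2, 4, 8, 18),
   (4, 6, 10, 16),
   (16, 18, 22, 28),
   (4, 6, 14, 28),
   (6, 8, 16, 26),
   (8, 10, 18, 28),
   (3, 4, 16, 27),
   (5, 6, 18, 25),
   (8, 9, 21, 28)]

/-- Normalized solutions with angles in `(π / 60) ℤ`. -/
theorem sixty_solutions {i j s t : ℕ} (hi : 0 < i) (hij : i < j) (hjs : j ≤ s) (hst : s < t)
    (htk : 2 * t ≤ 60) (h : SinRelation 60 i j s t) :
    InParametricFamily 60 i j s t ∨ (i, j, s, t) ∈ sixtyRows := by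
  -- Here `6481 = 54 * 120 + 1` provides elements of order 120, and no spurious solution appears
  -- modulo this prime.
  have := good_of_sineTableCheck (k := 60) (p := 6481) (g := 129) (by norm_num) (by norm_num)
    sineTableSixty (fun i j s t => decide (InParametricFamily 60 i j s t) ||
      decide ((i, j, s, t) ∈ sixtyRows)) (by decide +kernel) (by decide +kernel) (by decide +kernel)
    (by decide +kernel) (by decide +kernel) hi hij hjs hst htk h
  simpa using this

/-- Values of `g ^ x - g ^ (-x)` modulo `1429` for `g = 2` of order `84`. -/
def sineTableFortyTwo : List (ℕ × ℕ) :=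
  [(1, 716), (2, 361), (3, 901), (4, 1177), (5, 1327), (6, 1426), (7, 809), (8, 1311), (9, 325),
   (10, 216), (11, 215), (12, 1036), (13, 946), (14, 1329), (15, 233), (16, 1397), (17, 1116),
   (18, 1393), (19, 223), (20, 1308), (21, 189)]

def fortyTwoRows : List (ℕ × ℕ × ℕ × ℕ) :=
  [(2, 3, 9, 16),
   (3, 4, 10, 15),
   (8, 9, 15, 20)]

/-- Normalized solutions with angles in `(π / 42) ℤ`. -/
theorem fortyTwo_solutions {i j s t : ℕ} (hi : 0 < i) (hij : i < j) (hjs : j ≤ s) (hst : s < t)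
    (htk : 2 * t ≤ 42) (h : SinRelation 42 i j s t) :
    InParametricFamily 42 i j s t ∨ (i, j, s, t) ∈ fortyTwoRows := by
  -- Likewise `1429 = 17 * 84 + 1`.
  have := good_of_sineTableCheck (k := 42) (p := 1429) (g := 2) (by norm_num) (by norm_num)
    sineTableFortyTwo (fun i j s t => decide (InParametricFamily 42 i j s t) ||
      decide ((i, j, s, t) ∈ fortyTwoRows)) (by decide +kernel) (by decide +kernel) (by decide +kernel)
    (by decide +kernel) (by decide +kernel) hi hij hjs hst htk h
  simpa using this

/-! ### Rescaling the angles and the normalized solutions -/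

theorem SinRelation.rescale {k K i j s t i' j' s' t' : ℕ} (hk : 0 < k) (hK : 0 < K)
    (hi : K * i = k * i') (hj : K * j = k * j') (hs : K * s = k * s') (ht : K * t = k * t')
    (h : SinRelation k i j s t) : SinRelation K i' j' s' t' := by
  have key : ∀ {x y : ℕ}, K * x = k * y → Real.pi * y / K = Real.pi * x / k := by
    intro x y hxy
    have h1 : (k : ℝ) ≠ 0 := by exact_mod_cast hk.ne'
    have h2 : (K : ℝ) ≠ 0 := by exact_mod_cast hK.ne'
    have h3 : (K : ℝ) * x = k * y := by exact_mod_cast hxy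
    field_simp
    linear_combination -h3
  unfold SinRelation
  rw [key hi, key hj, key hs, key ht]
  exact h

/-- Sums and differences of the four angles give `2i`, `2j`, `2s`, `2t` up to multiples of `k`;
evenness of `K` absorbs both the factor 2 and the shift. -/
theorem exists_rescale {k K i j s t : ℕ} (hk : 0 < k) (hK : Even K)
    (h : ∀ n, (halfPhi k ^ cosAngles k i j s t n) ^ K = 1) :
    ∃ i' j' s' t' : ℕ, K * i = k * i' ∧ K * j = k * j' ∧ K * s = k * s' ∧ K * t = k * t' := by
  obtain ⟨L, rfl⟩ := hK
  have hd : ∀ n, ((2 * k : ℕ) : ℤ) ∣ cosAngles k i j s t n * (L + L : ℕ) := by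
    intro n
    rw [← (halfPhi_primitive hk).zpow_eq_one_iff_dvd, zpow_mul, zpow_natCast]
    exact h n
  obtain ⟨a, ha⟩ := hd 0
  obtain ⟨b, hb⟩ := hd 1
  obtain ⟨c, hc⟩ := hd 2
  obtain ⟨d, hd⟩ := hd 3
  simp only [cosAngles, Matrix.cons_val] at ha hb hc hd
  push_cast at ha hb hc hd
  have nat : ∀ x : ℕ, ∀ q : ℤ, ((L + L : ℕ) : ℤ) * x = k * q → ∃ x' : ℕ, (L + L) * x = k * x' := by
    intro x q hq
    have : (k : ℤ) ∣ (((L + L) * x : ℕ) : ℤ) := ⟨q, by push_cast at hq ⊢; exact hq⟩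
    exact Int.natCast_dvd_natCast.1 this
  obtain ⟨i', hi⟩ := nat i (a + b - L) (by push_cast; linarith)
  obtain ⟨t', ht⟩ := nat t (a - b + L) (by push_cast; linarith)
  obtain ⟨j', hj⟩ := nat j (L - c - d) (by push_cast; linarith)
  obtain ⟨s', hs⟩ := nat s (L - c + d) (by push_cast; linarith)
  exact ⟨i', j', s', t', hi, hj, hs, ht⟩

theorem InParametricFamily.rescale {k K i j s t i' j' s' t' : ℕ} (hK : 0 < K)
    (hi : K * i = k * i') (hj : K * j = k * j') (hs : K * s = k * s') (ht : K * t = k * t')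
    (h : InParametricFamily K i' j' s' t') : InParametricFamily k i j s t := by
  have key : ∀ {x y : ℕ}, K * x = K * y → x = y := fun h => Nat.eq_of_mul_eq_mul_left hK h
  rcases h with ⟨h1, h2, h3⟩ | ⟨h1, h2, h3⟩ | ⟨h1, h2, h3⟩
  · refine Or.inl ⟨key ?_, key ?_, key ?_⟩
    · linear_combination 6 * hj + k * h1
    · linear_combination hs - 2 * hi + k * h2
    · linear_combination ht + hi - 3 * hj + k * h3
  · refine Or.inr (Or.inl ⟨key ?_, key ?_, key ?_⟩)
    · linear_combination 6 * hs + k * h1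
    · linear_combination hj - 2 * hi + k * h2
    · linear_combination ht + hi - 3 * hs + k * h3
  · refine Or.inr (Or.inr ⟨key ?_, key ?_, key ?_⟩)
    · linear_combination 6 * hi + k * h1
    · linear_combination ht - 2 * hj + k * h2
    · linear_combination hs + hj - 3 * hi + k * h3

theorem exists_row {N k : ℕ} {o : Quad} (rows : ℕ → List (Quad × ℕ)) (n : ℕ)
    (h : n < (rows (k / N)).length) (hk : k = N * (k / N)) (ho : (rows (k / N))[n].1 = o) :
    ∃ m, k = N * m ∧ ∃ r ∈ rows m, r.1 = o :=
  ⟨k / N, hk, _, List.getElem_mem h, ho⟩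

/-- Classification of the normalized solutions of the sine relation. -/
theorem normalized_solutions {k i j s t : ℕ} (hi : 0 < i) (hij : i < j) (hjs : j ≤ s)
    (hst : s < t) (htk : 2 * t ≤ k) (h : SinRelation k i j s t) :
    InParametricFamily k i j s t ∨
      (∃ m, k = 30 * m ∧ ∃ r ∈ rows30 m, r.1 = ⟨i, j, s, t⟩) ∨
      (∃ m, k = 42 * m ∧ ∃ r ∈ rows42 m, r.1 = ⟨i, j, s, t⟩) ∨
      ∃ m, k = 60 * m ∧ ∃ r ∈ rows60 m, r.1 = ⟨i, j, s, t⟩ := by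
  have hk : 0 < k := by omega
  have lt : ∀ {K x y x' y' : ℕ}, 0 < K → K * x = k * x' → K * y = k * y' → x < y → x' < y' := by
    intro K x y x' y' hK h1 h2 hxy
    have := Nat.mul_lt_mul_of_pos_left hxy hK
    rw [h1, h2] at this
    exact lt_of_mul_lt_mul_left' this
  have le : ∀ {K x y x' y' : ℕ}, 0 < K → K * x = k * x' → K * y = k * y' → x ≤ y → x' ≤ y' := by
    intro K x y x' y' hK h1 h2 hxy
    have := Nat.mul_le_mul_left K hxy
    rw [h1, h2] at this
    exact Nat.le_of_mul_le_mul_left this hk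
  rcases cosRelation_or_small_order (2 * k) (by omega) (halfPhi_primitive hk) _ (h.sum_cos hk) with
    hc | hc | hc
  · exact Or.inl (parametric_of_cosRelation hi hij hjs hst htk h hc)
  · obtain ⟨i', j', s', t', ei, ej, es, et⟩ := exists_rescale hk (by decide) hc
    have hK : 0 < 60 := by norm_num
    rcases sixty_solutions (lt hK (mul_zero _) ei hi) (lt hK ei ej hij) (le hK ej es hjs)
      (lt hK es et hst) (le hK (by rw [mul_left_comm, et, mul_left_comm]) (mul_comm _ _) htk)
      (h.rescale hk hK ei ej es et) with hp | hr
    · exact Or.inl (hp.rescale hK ei ej es et)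
    · right
      simp only [sixtyRows, List.mem_cons, Prod.mk.injEq, List.not_mem_nil, or_false] at hr
      rcases hr with ⟨rfl, rfl, rfl, rfl⟩ | ⟨rfl, rfl, rfl, rfl⟩ | ⟨rfl, rfl, rfl, rfl⟩ |
        ⟨rfl, rfl, rfl, rfl⟩ | ⟨rfl, rfl, rfl, rfl⟩ | ⟨rfl, rfl, rfl, rfl⟩ |
        ⟨rfl, rfl, rfl, rfl⟩ | ⟨rfl, rfl, rfl, rfl⟩ | ⟨rfl, rfl, rfl, rfl⟩ |
        ⟨rfl, rfl, rfl, rfl⟩ | ⟨rfl, rfl, rfl, rfl⟩ | ⟨rfl, rfl, rfl, rfl⟩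
      · exact Or.inl (exists_row rows30 0 (by simp [rows30]) (by omega) (by simp [rows30]; omega))
      · exact Or.inl (exists_row rows30 1 (by simp [rows30]) (by omega) (by simp [rows30]; omega))
      · exact Or.inl (exists_row rows30 2 (by simp [rows30]) (by omega) (by simp [rows30]; omega))
      · exact Or.inl (exists_row rows30 3 (by simp [rows30]) (by omega) (by simp [rows30]; omega))
      · exact Or.inl (exists_row rows30 4 (by simp [rows30]) (by omega) (by simp [rows30]; omega))
      · exact Or.inl (exists_row rows30 5 (by simp [rows30]) (by omega) (by simp [rows30]; omega))
      · exact Or.inl (exists_row rows30 6 (by simp [rows30]) (by omega) (by simp [rows30]; omega))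
      · exact Or.inl (exists_row rows30 7 (by simp [rows30]) (by omega) (by simp [rows30]; omega))
      · exact Or.inl (exists_row rows30 8 (by simp [rows30]) (by omega) (by simp [rows30]; omega))
      · exact Or.inr (Or.inr (exists_row rows60 0 (by simp [rows60]) (by omega) (by simp [rows60]; omega)))
      · exact Or.inr (Or.inr (exists_row rows60 1 (by simp [rows60]) (by omega) (by simp [rows60]; omega)))
      · exact Or.inr (Or.inr (exists_row rows60 2 (by simp [rows60]) (by omega) (by simp [rows60]; omega)))
  · obtain ⟨i', j', s', t', ei, ej, es, et⟩ := exists_rescale hk (by decide) hc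
    have hK : 0 < 42 := by norm_num
    rcases fortyTwo_solutions (lt hK (mul_zero _) ei hi) (lt hK ei ej hij) (le hK ej es hjs)
      (lt hK es et hst) (le hK (by rw [mul_left_comm, et, mul_left_comm]) (mul_comm _ _) htk)
      (h.rescale hk hK ei ej es et) with hp | hr
    · exact Or.inl (hp.rescale hK ei ej es et)
    · right; right; left
      simp only [fortyTwoRows, List.mem_cons, Prod.mk.injEq, List.not_mem_nil, or_false] at hr
      rcases hr with ⟨rfl, rfl, rfl, rfl⟩ | ⟨rfl, rfl, rfl, rfl⟩ | ⟨rfl, rfl, rfl, rfl⟩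
      · exact exists_row rows42 0 (by simp [rows42]) (by omega) (by simp [rows42]; omega)
      · exact exists_row rows42 1 (by simp [rows42]) (by omega) (by simp [rows42]; omega)
      · exact exists_row rows42 2 (by simp [rows42]) (by omega) (by simp [rows42]; omega)

/-! ### Overlaps and their symmetries -/

theorem phi_primitive {k : ℕ} (hk : 0 < k) : IsPrimitiveRoot (phi k) k :=
  Complex.isPrimitiveRoot_exp _ hk.ne'

theorem phi_pow_sub_one_ne_zero {k x : ℕ} (hx : x ∈ exps k) : phi k ^ x - 1 ≠ 0 := by
  obtain ⟨h1, h2⟩ := hx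
  exact sub_ne_zero.2 ((phi_primitive (by omega)).pow_ne_one_of_pos_of_lt (by omega) h2)

theorem coset_eq_iff {k : ℕ} (hk : 0 < k) {x y : ℂ} :
    coset k x = coset k y ↔ ∃ z, z ^ k = 1 ∧ z * x = y := by
  constructor
  · intro h
    have : y ∈ coset k x := by
      rw [h]
      exact ⟨1, by simp [Phi], one_mul y⟩
    obtain ⟨z, hz, hzy⟩ := this
    exact ⟨z, hz, hzy⟩
  · rintro ⟨z, hz, rfl⟩
    have hz0 : z ≠ 0 := fun h => by rw [h, zero_pow hk.ne'] at hz; simp at hz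
    ext w
    constructor
    · rintro ⟨v, hv, rfl⟩
      refine ⟨v * z⁻¹, ?_, ?_⟩
      · have hv : v ^ k = 1 := hv
        simp [Phi, mul_pow, hv, hz]
      · simp only
        field_simp
    · rintro ⟨v, hv, rfl⟩
      refine ⟨v * z, ?_, ?_⟩
      · have hv : v ^ k = 1 := hv
        simp [Phi, mul_pow, hv, hz]
      · simp only
        ring

/-- The overlap condition in product form. -/
theorem mem_O_iff {k : ℕ} (hk : 0 < k) {o : Quad} :
    o ∈ O k ↔ o.InRange k ∧ ¬ o.Trivial k ∧ ∃ z, z ^ k = 1 ∧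
      z * ((phi k ^ o.j - 1) * (phi k ^ o.s - 1)) = (phi k ^ o.i - 1) * (phi k ^ o.t - 1) := by
  have key : o.InRange k → (coset k (c k o.i o.j) = coset k (c k o.s o.t) ↔ ∃ z, z ^ k = 1 ∧
      z * ((phi k ^ o.j - 1) * (phi k ^ o.s - 1)) = (phi k ^ o.i - 1) * (phi k ^ o.t - 1)) := by
    intro hr
    rw [coset_eq_iff hk]
    have hi := phi_pow_sub_one_ne_zero hr.1
    have hs := phi_pow_sub_one_ne_zero hr.2.2.1
    refine exists_congr fun z => and_congr_right fun _ => ?_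
    unfold c
    rw [← mul_div_assoc, div_eq_div_iff hi hs]
    constructor <;> intro h <;> linear_combination h
  constructor
  · rintro ⟨⟨hr, -, hc⟩, ht⟩
    exact ⟨hr, ht, (key hr).1 hc⟩
  · rintro ⟨hr, ht, hz⟩
    exact ⟨⟨hr, fun h => ht (Or.inr (Or.inr (Or.inl (Or.inl h)))), (key hr).2 hz⟩, ht⟩

theorem mem_O_of_identity {k : ℕ} (hk : 0 < k) {o : Quad} (hr : o.InRange k)
    (ht : ¬ o.Trivial k) {z : ℂ} (hz : z ^ k = 1) (h : z * c k o.i o.j = c k o.s o.t) :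
    o ∈ O k :=
  ⟨⟨hr, fun h => ht (Or.inr (Or.inr (Or.inl (Or.inl h)))), (coset_eq_iff hk).2 ⟨z, hz, h⟩⟩, ht⟩

/-- One has `φ^(-x) - 1 = -φ^(-x) (φ^x - 1)`, and `-φ^(-x)` is a `k`-th root of unity because `k` is
even. -/
theorem Flip.exists_unit {k : ℕ} (heven : Even k) {x y : ℕ} (hx : x ∈ exps k)
    (h : Flip k x y) : ∃ z : ℂ, z ^ k = 1 ∧ phi k ^ y - 1 = z * (phi k ^ x - 1) := by
  rcases h with rfl | rfl
  · exact ⟨1, one_pow _, (one_mul _).symm⟩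
  · obtain ⟨h1, h2⟩ := hx
    have hφ := phi_primitive (show 0 < k by omega)
    have h0 : phi k ^ x ≠ 0 := pow_ne_zero _ (hφ.ne_zero (by omega))
    have hm : phi k ^ (k - x) = (phi k ^ x)⁻¹ := by
      rw [← mul_eq_one_iff_eq_inv₀ h0, ← pow_add, Nat.sub_add_cancel h2.le, hφ.pow_eq_one]
    refine ⟨-(phi k ^ x)⁻¹, ?_, ?_⟩
    · rw [heven.neg_pow, inv_pow, ← pow_mul, mul_comm, pow_mul, hφ.pow_eq_one, one_pow, inv_one]
    · rw [hm]
      field_simp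
      ring

/-- The dihedral group preserves the partition `{i, t}`, `{j, s}`. Exchanging the two blocks inverts
the unit `z`; the pairs tested for triviality are those with one entry in each block. -/
theorem mem_O_of_mem_rearrangements {k : ℕ} (hk : 0 < k) {o p : Quad} (ho : o ∈ O k)
    (hp : p ∈ o.rearrangements) : p ∈ O k := by
  rw [mem_O_iff hk] at ho ⊢
  obtain ⟨⟨h1, h2, h3, h4⟩, ht, z, hz, hzeq⟩ := ho
  have hz0 : z ≠ 0 := fun h => by rw [h, zero_pow hk.ne'] at hz; simp at hz
  have hinv : z⁻¹ ^ k = 1 := by rw [inv_pow, hz, inv_one]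
  have hzeq' : z⁻¹ * ((phi k ^ o.i - 1) * (phi k ^ o.t - 1)) =
      (phi k ^ o.j - 1) * (phi k ^ o.s - 1) := by
    rw [← hzeq]
    field_simp
  simp only [Quad.rearrangements, List.mem_cons, List.not_mem_nil, or_false] at hp
  have htriv : ¬ p.Trivial k := by
    unfold Quad.Trivial at ht ⊢
    rcases hp with rfl | rfl | rfl | rfl | rfl | rfl | rfl | rfl <;> simp only <;> omega
  refine ⟨?_, htriv, ?_⟩
  · rcases hp with rfl | rfl | rfl | rfl | rfl | rfl | rfl | rfl <;>
      exact ⟨by assumption, by assumption, by assumption, by assumption⟩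
  · rcases hp with rfl | rfl | rfl | rfl | rfl | rfl | rfl | rfl <;> simp only <;>
      first
        | exact ⟨z, hz, by linear_combination hzeq⟩
        | exact ⟨z⁻¹, hinv, by linear_combination hzeq'⟩

theorem Flip.mem_exps {k x y : ℕ} (hx : x ∈ exps k) (h : Flip k x y) : y ∈ exps k := by
  unfold Flip at h
  simp only [exps, Set.mem_ofPred_eq] at hx ⊢
  omega

theorem mem_O_of_flip {k : ℕ} (hk : 0 < k) (heven : Even k) {p o : Quad} (hp : p ∈ O k)
    (fi : Flip k p.i o.i) (fj : Flip k p.j o.j) (fs : Flip k p.s o.s) (ft : Flip k p.t o.t) :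
    o ∈ O k := by
  rw [mem_O_iff hk] at hp ⊢
  obtain ⟨⟨h1, h2, h3, h4⟩, ht, z, hz, hzeq⟩ := hp
  refine ⟨⟨fi.mem_exps h1, fj.mem_exps h2, fs.mem_exps h3, ft.mem_exps h4⟩, ?_, ?_⟩
  · have back : ∀ {x y x' y' : ℕ}, x ∈ exps k → y ∈ exps k → Flip k x x' → Flip k y y' →
        x' = y' ∨ x' + y' = k → x = y ∨ x + y = k := by
      rintro x y x' y' ⟨h1, h2⟩ ⟨h3, h4⟩ h5 h6 h7
      unfold Flip at h5 h6
      omega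
    exact fun h => ht (h.imp (back h1 h2 fi fj) (Or.imp (back h3 h4 fs ft)
      (Or.imp (back h1 h3 fi fs) (back h2 h4 fj ft))))
  · obtain ⟨a, ha, ea⟩ := fi.exists_unit heven h1
    obtain ⟨b, hb, eb⟩ := fj.exists_unit heven h2
    obtain ⟨d, hd, ed⟩ := fs.exists_unit heven h3
    obtain ⟨e, he, ee⟩ := ft.exists_unit heven h4
    have ne : ∀ {w : ℂ}, w ^ k = 1 → w ≠ 0 := fun hw h => by
      rw [h, zero_pow hk.ne'] at hw; simp at hw
    refine ⟨z * a * e * b⁻¹ * d⁻¹, ?_, ?_⟩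
    · simp [mul_pow, hz, ha, hb, hd, he]
    · rw [ea, eb, ed, ee]
      have hb0 := ne hb
      have hd0 := ne hd
      field_simp
      linear_combination a * e * hzeq

theorem mem_O_of_sim {k : ℕ} (hk : 0 < k) (heven : Even k) {o o' : Quad} (ho : o ∈ O k)
    (h : Sim k o o') : o' ∈ O k := by
  obtain ⟨p, hp, fi, fj, fs, ft⟩ := h
  exact mem_O_of_flip hk heven (mem_O_of_mem_rearrangements hk ho hp) fi fj fs ft

theorem rearrangements_trans {o p q : Quad} (hp : p ∈ o.rearrangements)
    (hq : q ∈ p.rearrangements) : q ∈ o.rearrangements := by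
  simp only [Quad.rearrangements, List.mem_cons, List.not_mem_nil, or_false] at hp hq ⊢
  rcases hp with rfl | rfl | rfl | rfl | rfl | rfl | rfl | rfl <;>
    rcases hq with rfl | rfl | rfl | rfl | rfl | rfl | rfl | rfl <;> simp

theorem Sim.of_mem_rearrangements {k : ℕ} {o p q : Quad} (hp : p ∈ o.rearrangements)
    (h : Sim k p q) : Sim k o q := by
  obtain ⟨r, hr, h⟩ := h
  exact ⟨r, rearrangements_trans hp hr, h⟩

theorem sim_of_mem_rearrangements (k : ℕ) {o p : Quad} (hp : p ∈ o.rearrangements) : Sim k o p :=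
  ⟨p, hp, Or.inl rfl, Or.inl rfl, Or.inl rfl, Or.inl rfl⟩

/-! ### Absolute values and normalization -/

theorem norm_phi_pow_sub_one {k x : ℕ} (hx : x ∈ exps k) :
    ‖phi k ^ x - 1‖ = 2 * Real.sin (Real.pi * x / k) := by
  obtain ⟨h1, h2⟩ := hx
  have hk : (0 : ℝ) < k := by exact_mod_cast (show 0 < k by omega)
  have hk' : (k : ℂ) ≠ 0 := by exact_mod_cast hk.ne'
  have he : phi k ^ x = Complex.exp (Complex.I * ((2 * (Real.pi * x / k) : ℝ) : ℂ)) := by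
    rw [phi, ← Complex.exp_nat_mul]
    congr 1
    push_cast
    field_simp
  rw [he, Complex.norm_exp_I_mul_ofReal_sub_one, mul_div_cancel_left₀ _ two_ne_zero,
    Real.norm_eq_abs, abs_of_nonneg]
  have : 0 ≤ Real.sin (Real.pi * x / k) := by
    refine Real.sin_nonneg_of_nonneg_of_le_pi (by positivity) ?_
    rw [div_le_iff₀ hk]
    have : (x : ℝ) ≤ k := by exact_mod_cast h2.le
    exact mul_le_mul_of_nonneg_left this Real.pi_pos.le
  positivity

theorem sinRelation_of_mem_O {k : ℕ} (hk : 0 < k) {o : Quad} (ho : o ∈ O k) :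
    SinRelation k o.i o.j o.s o.t := by
  rw [mem_O_iff hk] at ho
  obtain ⟨⟨h1, h2, h3, h4⟩, -, z, hz, h⟩ := ho
  have := congrArg norm h
  rw [norm_mul, norm_mul, norm_mul, Complex.norm_eq_one_of_pow_eq_one hz hk.ne',
    norm_phi_pow_sub_one h1, norm_phi_pow_sub_one h2, norm_phi_pow_sub_one h3,
    norm_phi_pow_sub_one h4] at this
  unfold SinRelation
  linear_combination -this / 4

theorem sin_lt_sin_of_lt {k x y : ℕ} (hxy : x < y) (hy : 2 * y ≤ k) :
    Real.sin (Real.pi * x / k) < Real.sin (Real.pi * y / k) := by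
  have hk : (0 : ℝ) < k := by exact_mod_cast (show 0 < k by omega)
  have hy' : 2 * (y : ℝ) ≤ k := by exact_mod_cast hy
  have hxy' : (x : ℝ) < y := by exact_mod_cast hxy
  have hpi := Real.pi_pos
  refine Real.sin_lt_sin_of_lt_of_le_pi_div_two ?_ ?_ ?_
  · have : 0 ≤ Real.pi * x / k := by positivity
    linarith
  · rw [div_le_div_iff₀ hk two_pos]
    nlinarith
  · gcongr

/-- If `t < s`, both sines on the left would be smaller than their partners on the right, as sine
increases up to `π/2`. -/
theorem lt_of_sinRelation {k i j s t : ℕ} (hi : 0 < i) (hij : i < j) (hj : 2 * j ≤ k)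
    (hs : 0 < s) (hsk : 2 * s ≤ k) (hne : s ≠ t) (h : SinRelation k i j s t) : s < t := by
  by_contra hts
  have hts' : t < s := by omega
  have h1 := sin_lt_sin_of_lt hij hj
  have h2 := sin_lt_sin_of_lt hts' hsk
  have h0 := sin_lt_sin_of_lt hi (show 2 * i ≤ k by omega)
  have h0' := sin_lt_sin_of_lt hs hsk
  simp only [Nat.cast_zero, mul_zero, zero_div, Real.sin_zero] at h0 h0'
  unfold SinRelation at h
  nlinarith

/-- Every nontrivial overlap is equivalent to a normalized one. -/
theorem exists_normalized {k : ℕ} (hk : 0 < k) (heven : Even k) {o : Quad} (ho : o ∈ O k) :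
    ∃ p ∈ O k, p.Normalized k ∧ Sim k p o := by
  let q : Quad := ⟨min o.i (k - o.i), min o.j (k - o.j), min o.s (k - o.s), min o.t (k - o.t)⟩
  have hfold : ∀ x : ℕ, Flip k x (min x (k - x)) := by intro x; unfold Flip; omega
  have hfold' : ∀ x ∈ exps k, Flip k (min x (k - x)) x := by
    rintro x ⟨h1, h2⟩; unfold Flip; omega
  have hq : q ∈ O k := mem_O_of_flip hk heven ho (hfold _) (hfold _) (hfold _) (hfold _)
  have hr := ho.1.1
  suffices H : ∃ p ∈ O k, p.Normalized k ∧ q ∈ p.rearrangements by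
    obtain ⟨p, hp, hn, hqp⟩ := H
    exact ⟨p, hp, hn, q, hqp, hfold' _ hr.1, hfold' _ hr.2.1, hfold' _ hr.2.2.1,
      hfold' _ hr.2.2.2⟩
  have hsmall : (0 < q.i ∧ 2 * q.i ≤ k) ∧ (0 < q.j ∧ 2 * q.j ≤ k) ∧ (0 < q.s ∧ 2 * q.s ≤ k) ∧
      (0 < q.t ∧ 2 * q.t ≤ k) := by
    obtain ⟨⟨h1, h2⟩, ⟨h3, h4⟩, ⟨h5, h6⟩, h7, h8⟩ := hr
    simp only [q]
    omega
  clear_value q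
  clear hfold hfold' hr
  -- Only the first three entries need sorting; `s < t` then follows from the sine relation.
  have finish : ∀ p : Quad, p ∈ q.rearrangements → q ∈ p.rearrangements → p.i < p.j → p.j ≤ p.s →
      ∃ p ∈ O k, p.Normalized k ∧ q ∈ p.rearrangements := by
    intro p hp hqp h1 h2
    have hpO := mem_O_of_mem_rearrangements hk hq hp
    have hps : (0 < p.i ∧ 2 * p.i ≤ k) ∧ (0 < p.j ∧ 2 * p.j ≤ k) ∧ (0 < p.s ∧ 2 * p.s ≤ k) ∧
        (0 < p.t ∧ 2 * p.t ≤ k) := by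
      simp only [Quad.rearrangements, List.mem_cons, List.not_mem_nil, or_false] at hp
      rcases hp with rfl | rfl | rfl | rfl | rfl | rfl | rfl | rfl <;> simp only <;> omega
    have hne : p.s ≠ p.t := fun h => hpO.2 (Or.inr (Or.inl (Or.inl h)))
    have := lt_of_sinRelation hps.1.1 h1 hps.2.1.2 hps.2.2.1.1 hps.2.2.1.2 hne
      (sinRelation_of_mem_O hk hpO)
    exact ⟨p, hpO, ⟨hps.1.1, h1, h2, this, hps.2.2.2.2⟩, hqp⟩
  have ht := hq.2
  unfold Quad.Trivial at ht
  -- The dihedral group moves a smallest entry to the first place; the swap of `j` and `s` orders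
  -- the middle.
  have hmin : (q.i ≤ q.j ∧ q.i ≤ q.s ∧ q.i ≤ q.t) ∨ (q.j ≤ q.i ∧ q.j ≤ q.s ∧ q.j ≤ q.t) ∨
      (q.s ≤ q.i ∧ q.s ≤ q.j ∧ q.s ≤ q.t) ∨ (q.t ≤ q.i ∧ q.t ≤ q.j ∧ q.t ≤ q.s) := by omega
  rcases hmin with h | h | h | h
  · rcases le_total q.j q.s with h' | h'
    · exact finish ⟨q.i, q.j, q.s, q.t⟩ (by simp [Quad.rearrangements])
        (by simp [Quad.rearrangements]) (by simp only; omega) h'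
    · exact finish ⟨q.i, q.s, q.j, q.t⟩ (by simp [Quad.rearrangements])
        (by simp [Quad.rearrangements]) (by simp only; omega) h'
  · rcases le_total q.i q.t with h' | h'
    · exact finish ⟨q.j, q.i, q.t, q.s⟩ (by simp [Quad.rearrangements])
        (by simp [Quad.rearrangements]) (by simp only; omega) h'
    · exact finish ⟨q.j, q.t, q.i, q.s⟩ (by simp [Quad.rearrangements])
        (by simp [Quad.rearrangements]) (by simp only; omega) h'
  · rcases le_total q.i q.t with h' | h'
    · exact finish ⟨q.s, q.i, q.t, q.j⟩ (by simp [Quad.rearrangements])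
        (by simp [Quad.rearrangements]) (by simp only; omega) h'
    · exact finish ⟨q.s, q.t, q.i, q.j⟩ (by simp [Quad.rearrangements])
        (by simp [Quad.rearrangements]) (by simp only; omega) h'
  · rcases le_total q.j q.s with h' | h'
    · exact finish ⟨q.t, q.j, q.s, q.i⟩ (by simp [Quad.rearrangements])
        (by simp [Quad.rearrangements]) (by simp only; omega) h'
    · exact finish ⟨q.t, q.s, q.j, q.i⟩ (by simp [Quad.rearrangements])
        (by simp [Quad.rearrangements]) (by simp only; omega) h'

/-- Below `k/2` flips do nothing. In normalized form `i` is the strict minimum and `t` the strict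
maximum, so a rearrangement can only swap `j` and `s`, and then they are equal. -/
theorem eq_of_sim_of_normalized {k : ℕ} {p o : Quad} (hp : p.Normalized k) (ho : o.Normalized k)
    (h : Sim k p o) : o = p := by
  obtain ⟨q, hq, fi, fj, fs, ft⟩ := h
  obtain ⟨i, j, s, t⟩ := p
  obtain ⟨i', j', s', t'⟩ := o
  unfold Quad.Normalized at hp ho
  simp only at hp ho
  have key : ∀ {x y : ℕ}, 2 * x ≤ k → 2 * y ≤ k → Flip k x y → y = x := by
    intro x y hx hy h
    unfold Flip at h
    omega
  rw [Quad.mk.injEq]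
  simp only [Quad.rearrangements, List.mem_cons, List.not_mem_nil, or_false] at hq
  rcases hq with rfl | rfl | rfl | rfl | rfl | rfl | rfl | rfl <;>
  · have e1 := key (by simp only; omega) (by simp only; omega) fi
    have e2 := key (by simp only; omega) (by simp only; omega) fj
    have e3 := key (by simp only; omega) (by simp only; omega) fs
    have e4 := key (by simp only; omega) (by simp only; omega) ft
    simp only at e1 e2 e3 e4
    omega

/-! ### Cyclotomic identities behind the families -/

theorem IsPrimitiveRoot.pow_half {ψ : ℂ} {n : ℕ} (hn : 0 < n) (h : IsPrimitiveRoot ψ (2 * n)) :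
    ψ ^ n = -1 :=
  (h.pow (by omega) (mul_comm 2 n)).eq_neg_one_of_two_right

/-- Dividing `ψ ^ 15 + 1` by `ψ ^ 5 + 1` and by `ψ ^ 3 + 1` gives two relations; a Bézout
combination of them is the cyclotomic polynomial. -/
theorem cyclotomic_30_root {ψ : ℂ} (h : IsPrimitiveRoot ψ 30) :
    ψ ^ 8 + ψ ^ 7 - ψ ^ 5 - ψ ^ 4 - ψ ^ 3 + ψ + 1 = 0 := by
  have h15 : ψ ^ 15 = -1 := IsPrimitiveRoot.pow_half (n := 15) (by norm_num) h
  have h1 : ψ ^ 5 + 1 ≠ 0 := fun hh => h.pow_ne_one_of_pos_of_lt (l := 10) (by norm_num)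
    (by norm_num) (by linear_combination (ψ ^ 5 - 1) * hh)
  have h2 : ψ ^ 3 + 1 ≠ 0 := fun hh => h.pow_ne_one_of_pos_of_lt (l := 6) (by norm_num)
    (by norm_num) (by linear_combination (ψ ^ 3 - 1) * hh)
  have h3 : ψ ^ 10 - ψ ^ 5 + 1 = 0 :=
    mul_left_cancel₀ h1 (by linear_combination h15)
  have h4 : ψ ^ 12 - ψ ^ 9 + ψ ^ 6 - ψ ^ 3 + 1 = 0 :=
    mul_left_cancel₀ h2 (by linear_combination h15)
  linear_combination
    (-ψ ^ 3 + 1) * h3 +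
      (ψ) * h4

theorem cyclotomic_42_root {ψ : ℂ} (h : IsPrimitiveRoot ψ 42) :
    ψ ^ 12 + ψ ^ 11 - ψ ^ 9 - ψ ^ 8 + ψ ^ 6 - ψ ^ 4 - ψ ^ 3 + ψ + 1 = 0 := by
  have h21 : ψ ^ 21 = -1 := IsPrimitiveRoot.pow_half (n := 21) (by norm_num) h
  have h1 : ψ ^ 7 + 1 ≠ 0 := fun hh => h.pow_ne_one_of_pos_of_lt (l := 14) (by norm_num)
    (by norm_num) (by linear_combination (ψ ^ 7 - 1) * hh)
  have h2 : ψ ^ 3 + 1 ≠ 0 := fun hh => h.pow_ne_one_of_pos_of_lt (l := 6) (by norm_num)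
    (by norm_num) (by linear_combination (ψ ^ 3 - 1) * hh)
  have h3 : ψ ^ 14 - ψ ^ 7 + 1 = 0 :=
    mul_left_cancel₀ h1 (by linear_combination h21)
  have h4 : ψ ^ 18 - ψ ^ 15 + ψ ^ 12 - ψ ^ 9 + ψ ^ 6 - ψ ^ 3 + 1 = 0 :=
    mul_left_cancel₀ h2 (by linear_combination h21)
  linear_combination
    (-ψ ^ 4 + ψ) * h3 +
      (1) * h4

theorem cyclotomic_60_root {ψ : ℂ} (h : IsPrimitiveRoot ψ 60) :
    ψ ^ 16 + ψ ^ 14 - ψ ^ 10 - ψ ^ 8 - ψ ^ 6 + ψ ^ 2 + 1 = 0 := by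
  have := cyclotomic_30_root (h.pow (by norm_num) (show 60 = 2 * 30 by norm_num))
  linear_combination this

/-- It suffices to prove the cross-multiplied identity for primitive `N`-th roots, since `φ^m` is
one. -/
theorem c_identity {k N m i j s t ω : ℕ} (hk : 0 < k) (hkm : k = N * m) (hi : i ∈ exps N)
    (hs : s ∈ exps N)
    (h : ∀ ψ : ℂ, IsPrimitiveRoot ψ N →
      ψ ^ ω * (ψ ^ j - 1) * (ψ ^ s - 1) = (ψ ^ t - 1) * (ψ ^ i - 1)) :
    phi k ^ (ω * m) * c k (i * m) (j * m) = c k (s * m) (t * m) := by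
  have hψ : IsPrimitiveRoot (phi k ^ m) N := (phi_primitive hk).pow hk (by rw [hkm, mul_comm])
  have hne : ∀ x ∈ exps N, (phi k ^ m) ^ x - 1 ≠ 0 := by
    rintro x ⟨h1, h2⟩
    exact sub_ne_zero.2 (hψ.pow_ne_one_of_pos_of_lt (by omega) h2)
  unfold c
  simp only [mul_comm _ m, pow_mul]
  rw [← mul_div_assoc, div_eq_div_iff (hne i hi) (hne s hs)]
  exact h _ hψ

theorem rows30_identity {k m : ℕ} (hk : 0 < k) (hkm : k = 30 * m) :
    ∀ r ∈ rows30 m, phi k ^ r.2 * c k r.1.i r.1.j = c k r.1.s r.1.t := by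
  have key : ∀ i j s t ω : ℕ, i ∈ exps 30 → s ∈ exps 30 → (∀ ψ : ℂ, IsPrimitiveRoot ψ 30 →
      ψ ^ ω * (ψ ^ j - 1) * (ψ ^ s - 1) = (ψ ^ t - 1) * (ψ ^ i - 1)) →
      phi k ^ (ω * m) * c k (i * m) (j * m) = c k (s * m) (t * m) :=
    fun i j s t ω hi hs h => c_identity hk hkm hi hs h
  intro r hr
  simp only [rows30, List.mem_cons, List.not_mem_nil, or_false] at hr
  rcases hr with rfl | rfl | rfl | rfl | rfl | rfl | rfl | rfl | rfl
  -- In each row the cofactor is the quotient of the difference of both sides by the cyclotomic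
  -- polynomial.
  · simpa using key 1 3 3 11 3 (by simp [exps]) (by simp [exps]) fun ψ h => by
      linear_combination
        (-ψ ^ 4 + 2 * ψ ^ 3 - 2 * ψ ^ 2 + 2 * ψ - 1) * cyclotomic_30_root h
  · simpa using key 3 5 5 9 1 (by simp [exps]) (by simp [exps]) fun ψ h => by
      linear_combination
        (-ψ ^ 4 + 2 * ψ ^ 3 - 2 * ψ ^ 2 + 2 * ψ - 1) * cyclotomic_30_root h
  · simpa using key 7 9 9 13 1 (by simp [exps]) (by simp [exps]) fun ψ h => by
      linear_combination
        (-ψ ^ 12 + 2 * ψ ^ 11 - 2 * ψ ^ 10 + ψ ^ 9 - ψ ^ 7 + 2 * ψ ^ 6 - ψ ^ 5 + ψ ^ 3 - 2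
          * ψ ^ 2 + 2 * ψ - 1) * cyclotomic_30_root h
  · simpa using key 1 2 4 9 2 (by simp [exps]) (by simp [exps]) fun ψ h => by
      linear_combination
        (-ψ ^ 2 + 2 * ψ - 1) * cyclotomic_30_root h
  · simpa using key 2 3 5 8 1 (by simp [exps]) (by simp [exps]) fun ψ h => by
      linear_combination
        (-ψ ^ 2 + 2 * ψ - 1) * cyclotomic_30_root h
  · simpa using key 8 9 11 14 1 (by simp [exps]) (by simp [exps]) fun ψ h => by
      linear_combination
        (-ψ ^ 14 + 2 * ψ ^ 13 - 2 * ψ ^ 12 + ψ ^ 11 - ψ ^ 9 + 2 * ψ ^ 8 - 2 * ψ ^ 7 + 2 *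
          ψ ^ 6 - ψ ^ 5 + ψ ^ 3 - 2 * ψ ^ 2 + 2 * ψ - 1) * cyclotomic_30_root h
  · simpa using key 2 3 7 14 3 (by simp [exps]) (by simp [exps]) fun ψ h => by
      linear_combination
        (-ψ ^ 8 + ψ ^ 7 + ψ - 1) * cyclotomic_30_root h
  · simpa using key 3 4 8 13 2 (by simp [exps]) (by simp [exps]) fun ψ h => by
      linear_combination
        (-ψ ^ 8 + ψ ^ 7 + ψ - 1) * cyclotomic_30_root h
  · simpa using key 4 5 9 14 2 (by simp [exps]) (by simp [exps]) fun ψ h => by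
      linear_combination
        (-ψ ^ 10 + ψ ^ 9 - ψ ^ 7 + 2 * ψ ^ 6 - 2 * ψ ^ 5 + 2 * ψ ^ 4 - ψ ^ 3 + ψ - 1) *
          cyclotomic_30_root h

theorem rows42_identity {k m : ℕ} (hk : 0 < k) (hkm : k = 42 * m) :
    ∀ r ∈ rows42 m, phi k ^ r.2 * c k r.1.i r.1.j = c k r.1.s r.1.t := by
  have key : ∀ i j s t ω : ℕ, i ∈ exps 42 → s ∈ exps 42 → (∀ ψ : ℂ, IsPrimitiveRoot ψ 42 →
      ψ ^ ω * (ψ ^ j - 1) * (ψ ^ s - 1) = (ψ ^ t - 1) * (ψ ^ i - 1)) →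
      phi k ^ (ω * m) * c k (i * m) (j * m) = c k (s * m) (t * m) :=
    fun i j s t ω hi hs h => c_identity hk hkm hi hs h
  intro r hr
  simp only [rows42, List.mem_cons, List.not_mem_nil, or_false] at hr
  rcases hr with rfl | rfl | rfl
  · simpa using key 2 3 9 16 3 (by simp [exps]) (by simp [exps]) fun ψ h => by
      linear_combination
        (-ψ ^ 6 + ψ ^ 5 + ψ - 1) * cyclotomic_42_root h
  · simpa using key 3 4 10 15 2 (by simp [exps]) (by simp [exps]) fun ψ h => by
      linear_combination
        (-ψ ^ 6 + ψ ^ 5 + ψ - 1) * cyclotomic_42_root h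
  · simpa using key 8 9 15 20 2 (by simp [exps]) (by simp [exps]) fun ψ h => by
      linear_combination
        (-ψ ^ 16 + ψ ^ 15 - ψ ^ 13 + ψ ^ 12 - ψ ^ 9 + 2 * ψ ^ 8 - ψ ^ 7 + ψ ^ 4 - ψ ^ 3 +
          ψ - 1) * cyclotomic_42_root h

theorem rows60_identity {k m : ℕ} (hk : 0 < k) (hkm : k = 60 * m) :
    ∀ r ∈ rows60 m, phi k ^ r.2 * c k r.1.i r.1.j = c k r.1.s r.1.t := by
  have key : ∀ i j s t ω : ℕ, i ∈ exps 60 → s ∈ exps 60 → (∀ ψ : ℂ, IsPrimitiveRoot ψ 60 →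
      ψ ^ ω * (ψ ^ j - 1) * (ψ ^ s - 1) = (ψ ^ t - 1) * (ψ ^ i - 1)) →
      phi k ^ (ω * m) * c k (i * m) (j * m) = c k (s * m) (t * m) :=
    fun i j s t ω hi hs h => c_identity hk hkm hi hs h
  intro r hr
  simp only [rows60, List.mem_cons, List.not_mem_nil, or_false] at hr
  rcases hr with rfl | rfl | rfl
  · simpa using key 3 4 16 27 5 (by simp [exps]) (by simp [exps]) fun ψ h => by
      linear_combination
        (-ψ ^ 14 + ψ ^ 12 + ψ ^ 11 - ψ ^ 10 - ψ ^ 4 + ψ ^ 3 + ψ ^ 2 - 1) *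
          cyclotomic_60_root h
  · simpa using key 5 6 18 25 3 (by simp [exps]) (by simp [exps]) fun ψ h => by
      linear_combination
        (-ψ ^ 14 + ψ ^ 12 + ψ ^ 11 - ψ ^ 10 - ψ ^ 4 + ψ ^ 3 + ψ ^ 2 - 1) *
          cyclotomic_60_root h
  · simpa using key 8 9 21 28 3 (by simp [exps]) (by simp [exps]) fun ψ h => by
      linear_combination
        (-ψ ^ 20 + ψ ^ 18 + ψ ^ 17 - ψ ^ 16 - ψ ^ 15 + ψ ^ 13 + ψ ^ 12 - 2 * ψ ^ 10 + ψ ^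
          8 + ψ ^ 7 - ψ ^ 5 - ψ ^ 4 + ψ ^ 3 + ψ ^ 2 - 1) * cyclotomic_60_root h

/-- Put `x = φ^u`, `y = φ^ℓ`. Then `y² - y = -1` and `φ^(3ℓ-u) = -1/x`, so both sides equal `-1 / (x
(x - 1))`. -/
theorem parametric_identity {k l u : ℕ} (hk : 0 < k) (hkl : k = 6 * l) (hu : 1 ≤ u)
    (huk : u ≤ k / 4) :
    phi k ^ ((l : ℤ) - (u : ℤ)) * c k u l = c k (2 * u) (3 * l - u) := by
  have hφ := phi_primitive hk
  have h0 : phi k ≠ 0 := hφ.ne_zero hk.ne'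
  have hu1 : phi k ^ u - 1 ≠ 0 := phi_pow_sub_one_ne_zero ⟨hu, by omega⟩
  have hu2 : phi k ^ (2 * u) - 1 ≠ 0 := phi_pow_sub_one_ne_zero ⟨by omega, by omega⟩
  have h3 : (phi k ^ l) ^ 3 = -1 := by
    rw [← pow_mul, mul_comm]
    exact IsPrimitiveRoot.pow_half (by omega) (by rwa [show 2 * (3 * l) = k by omega])
  have h2 : phi k ^ l + 1 ≠ 0 := fun hh =>
    hφ.pow_ne_one_of_pos_of_lt (l := 2 * l) (by omega) (by omega)
      (by rw [mul_comm, pow_mul]; linear_combination (phi k ^ l - 1) * hh)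
  have h6 : (phi k ^ l) ^ 2 - phi k ^ l + 1 = 0 := mul_left_cancel₀ h2 (by linear_combination h3)
  have ht : phi k ^ (3 * l - u) = -(phi k ^ u)⁻¹ := by
    rw [pow_sub₀ _ h0 (by omega), mul_comm 3 l, pow_mul, h3, neg_one_mul]
  unfold c
  rw [zpow_sub₀ h0, zpow_natCast, zpow_natCast, ht]
  rw [mul_comm 2 u, pow_mul] at hu2 ⊢
  have hx : phi k ^ u ≠ 0 := pow_ne_zero _ h0
  generalize phi k ^ u = x at *
  generalize phi k ^ l = y at *
  field_simp
  linear_combination (x ^ 2 - 1) * h6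

theorem parametric_mem_O {k l u : ℕ} (hk : 0 < k) (hkl : k = 6 * l) (hu : 1 ≤ u) (huk : u ≤ k / 4)
    (hul : u ≠ l) : (⟨u, l, 2 * u, 3 * l - u⟩ : Quad) ∈ O k := by
  refine mem_O_of_identity hk ?_ ?_ (z := phi k ^ ((l : ℤ) - (u : ℤ))) ?_
    (parametric_identity hk hkl hu huk)
  · simp only [Quad.InRange, exps, Set.mem_ofPred_eq]
    omega
  · simp only [Quad.Trivial]
    omega
  · rw [← zpow_natCast, ← zpow_mul, mul_comm, zpow_mul, zpow_natCast,
      (phi_primitive hk).pow_eq_one, one_zpow]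

theorem Quad.Normalized.mem_O_of_identity {k ω : ℕ} (hk : 0 < k) {o : Quad} (ho : o.Normalized k)
    (h : phi k ^ ω * c k o.i o.j = c k o.s o.t) : o ∈ O k := by
  unfold Quad.Normalized at ho
  refine CircularOverlap.mem_O_of_identity hk ?_ ?_ ?_ h
  · simp only [Quad.InRange, exps, Set.mem_ofPred_eq]
    omega
  · simp only [Quad.Trivial]
    omega
  · rw [← pow_mul, mul_comm, pow_mul, (phi_primitive hk).pow_eq_one, one_pow]

/-! ### Assembling the classification and the triple overlaps -/

theorem rows30_normalized {k m : ℕ} (hk : 0 < k) (hkm : k = 30 * m) :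
    ∀ r ∈ rows30 m, r.1.Normalized k := by
  intro r hr
  unfold Quad.Normalized
  simp only [rows30, List.mem_cons, List.not_mem_nil, or_false] at hr
  rcases hr with rfl | rfl | rfl | rfl | rfl | rfl | rfl | rfl | rfl <;> simp only <;> omega

theorem rows42_normalized {k m : ℕ} (hk : 0 < k) (hkm : k = 42 * m) :
    ∀ r ∈ rows42 m, r.1.Normalized k := by
  intro r hr
  unfold Quad.Normalized
  simp only [rows42, List.mem_cons, List.not_mem_nil, or_false] at hr
  rcases hr with rfl | rfl | rfl <;> simp only <;> omega

theorem rows60_normalized {k m : ℕ} (hk : 0 < k) (hkm : k = 60 * m) :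
    ∀ r ∈ rows60 m, r.1.Normalized k := by
  intro r hr
  unfold Quad.Normalized
  simp only [rows60, List.mem_cons, List.not_mem_nil, or_false] at hr
  rcases hr with rfl | rfl | rfl <;> simp only <;> omega

theorem mem_O_of_mem_family {N k : ℕ} {rows : ℕ → List (Quad × ℕ)} (hk : 0 < k) (heven : Even k)
    (hnorm : ∀ m, k = N * m → ∀ r ∈ rows m, r.1.Normalized k)
    (hid : ∀ m, k = N * m → ∀ r ∈ rows m, phi k ^ r.2 * c k r.1.i r.1.j = c k r.1.s r.1.t)
    {o : Quad} (ho : o ∈ OFamily N rows k) : o ∈ O k := by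
  obtain ⟨m, hm, r, hr, hsim⟩ := ho
  exact mem_O_of_sim hk heven ((hnorm m hm r hr).mem_O_of_identity hk (hid m hm r hr)) hsim

theorem rowsCorrect_of_identity {N k : ℕ} {rows : ℕ → List (Quad × ℕ)} (hN : 0 < N)
    (hnorm : ∀ m, k = N * m → ∀ r ∈ rows m, r.1.Normalized k)
    (hid : ∀ m, k = N * m → ∀ r ∈ rows m, phi k ^ r.2 * c k r.1.i r.1.j = c k r.1.s r.1.t) :
    RowsCorrect N rows k := by
  intro m hm
  refine ⟨fun o => ⟨?_, ?_⟩, hid m hm⟩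
  · rintro ⟨⟨m', hm', r, hr, hsim⟩, ho⟩
    obtain rfl : m = m' := Nat.eq_of_mul_eq_mul_left hN (hm.symm.trans hm')
    exact ⟨r, hr, (eq_of_sim_of_normalized (hnorm m hm r hr) ho hsim).symm⟩
  · rintro ⟨r, hr, rfl⟩
    exact ⟨⟨m, hm, r, hr, sim_of_mem_rearrangements k (by simp [Quad.rearrangements])⟩,
      hnorm m hm r hr⟩

theorem mem_O1_of_parametric {k : ℕ} {p o : Quad} (hp : p.Normalized k)
    (h : InParametricFamily k p.i p.j p.s p.t) (hsim : Sim k p o) : o ∈ O1 k := by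
  obtain ⟨i, j, s, t⟩ := p
  unfold Quad.Normalized at hp
  unfold InParametricFamily at h
  simp only at hp h
  -- The three cases are `u < ℓ ≤ 2u`, `2u ≤ ℓ` and `ℓ < u`, which sort the entries of the family
  -- differently.
  rcases h with ⟨h1, h2, h3⟩ | ⟨h1, h2, h3⟩ | ⟨h1, h2, h3⟩
  · refine ⟨j, i, by omega, by omega, by omega, by omega, hsim.of_mem_rearrangements ?_⟩
    simp only [show 3 * j - i = t by omega, ← h2, Quad.rearrangements, List.mem_cons, true_or]
  · refine ⟨s, i, by omega, by omega, by omega, by omega, hsim.of_mem_rearrangements ?_⟩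
    simp only [show 3 * s - i = t by omega, ← h2, Quad.rearrangements, List.mem_cons, true_or,
      or_true]
  · refine ⟨i, j, by omega, by omega, by omega, by omega, hsim.of_mem_rearrangements ?_⟩
    simp only [show 3 * i - j = s by omega, ← h2, Quad.rearrangements, List.mem_cons, true_or,
      or_true]

theorem mem_families_of_mem_O {k : ℕ} (hk : 0 < k) (heven : Even k) {o : Quad} (ho : o ∈ O k) :
    o ∈ O1 k ∪ O30 k ∪ O42 k ∪ O60 k := by
  obtain ⟨p, hp, hn, hsim⟩ := exists_normalized hk heven ho
  have hn' := hn
  obtain ⟨h1, h2, h3, h4, h5⟩ := hn'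
  rcases normalized_solutions h1 h2 h3 h4 h5 (sinRelation_of_mem_O hk hp) with
    h | ⟨m, hm, r, hr, hrp⟩ | ⟨m, hm, r, hr, hrp⟩ | ⟨m, hm, r, hr, hrp⟩
  · exact Or.inl (Or.inl (Or.inl (mem_O1_of_parametric hn h hsim)))
  · exact Or.inl (Or.inl (Or.inr ⟨m, hm, r, hr, hrp ▸ hsim⟩))
  · exact Or.inl (Or.inr ⟨m, hm, r, hr, hrp ▸ hsim⟩)
  · exact Or.inr ⟨m, hm, r, hr, hrp ▸ hsim⟩

theorem O_eq_union {k : ℕ} (hk : 0 < k) (heven : Even k) :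
    O k = O1 k ∪ O30 k ∪ O42 k ∪ O60 k := by
  ext o
  refine ⟨mem_families_of_mem_O hk heven, ?_⟩
  rintro (((⟨l, u, hl, h1, h2, h3, hsim⟩ | h) | h) | h)
  · exact mem_O_of_sim hk heven (parametric_mem_O hk hl h1 h2 h3) hsim
  · exact mem_O_of_mem_family hk heven (fun _ => rows30_normalized hk)
      (fun _ => rows30_identity hk) h
  · exact mem_O_of_mem_family hk heven (fun _ => rows42_normalized hk)
      (fun _ => rows42_identity hk) h
  · exact mem_O_of_mem_family hk heven (fun _ => rows60_normalized hk)
      (fun _ => rows60_identity hk) h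

theorem tripleOverlaps_thirty {k m : ℕ} (hk : 0 < k) (hkm : k = 30 * m) :
    T1 m ∈ TripleOverlaps k ∧ T2 m ∈ TripleOverlaps k ∧ T3 m ∈ TripleOverlaps k ∧
      T4 m ∈ TripleOverlaps k ∧ T5 m ∈ TripleOverlaps k := by
  have row : ∀ r ∈ rows30 m, ∀ p ∈ r.1.rearrangements, p ∈ O k := fun r hr p hp =>
    mem_O_of_mem_rearrangements hk
      ((rows30_normalized hk hkm r hr).mem_O_of_identity hk (rows30_identity hk hkm r hr)) hp
  -- Constituents outside the list come from the one-parameter family with `ℓ = 5m`.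
  have par : ∀ u v w, 1 ≤ u → w = 2 * u → u + v = 15 * m → u ≤ k / 4 → u ≠ 5 * m →
      ∀ p ∈ (⟨u, 5 * m, w, v⟩ : Quad).rearrangements, p ∈ O k := by
    rintro u v w h1 rfl h2 h3 h4 p hp
    obtain rfl : v = 3 * (5 * m) - u := by omega
    exact mem_O_of_mem_rearrangements hk (parametric_mem_O hk (by omega) h1 h3 h4) hp
  refine ⟨?_, ?_, ?_, ?_, ?_⟩ <;> intro o ho <;>
    simp only [Triple.constituents, T1, T2, T3, T4, T5, List.mem_cons, List.not_mem_nil,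
      or_false] at ho <;>
    rcases ho with rfl | rfl | rfl
  · exact row (⟨3 * m, 5 * m, 5 * m, 9 * m⟩, m) (by simp [rows30]) _
      (by simp [Quad.rearrangements])
  · exact par (6 * m) (9 * m) (12 * m) (by omega) (by ring) (by ring) (by omega) (by omega) _
      (by simp [Quad.rearrangements])
  · exact par (3 * m) (12 * m) (6 * m) (by omega) (by ring) (by ring) (by omega) (by omega) _
      (by simp [Quad.rearrangements])
  · exact row (⟨m, 2 * m, 4 * m, 9 * m⟩, 2 * m) (by simp [rows30]) _
      (by simp [Quad.rearrangements])
  · exact row (⟨4 * m, 5 * m, 9 * m, 14 * m⟩, 2 * m) (by simp [rows30]) _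
      (by simp [Quad.rearrangements])
  · exact par (m) (14 * m) (2 * m) (by omega) (by ring) (by ring) (by omega) (by omega) _
      (by simp [Quad.rearrangements])
  · exact row (⟨2 * m, 3 * m, 5 * m, 8 * m⟩, m) (by simp [rows30]) _
      (by simp [Quad.rearrangements])
  · exact par (7 * m) (8 * m) (14 * m) (by omega) (by ring) (by ring) (by omega) (by omega) _
      (by simp [Quad.rearrangements])
  · exact row (⟨2 * m, 3 * m, 7 * m, 14 * m⟩, 3 * m) (by simp [rows30]) _
      (by simp [Quad.rearrangements])
  · exact row (⟨2 * m, 3 * m, 5 * m, 8 * m⟩, m) (by simp [rows30]) _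
      (by simp [Quad.rearrangements])
  · exact row (⟨3 * m, 4 * m, 8 * m, 13 * m⟩, 2 * m) (by simp [rows30]) _
      (by simp [Quad.rearrangements])
  · exact par (2 * m) (13 * m) (4 * m) (by omega) (by ring) (by ring) (by omega) (by omega) _
      (by simp [Quad.rearrangements])
  · exact par (4 * m) (11 * m) (8 * m) (by omega) (by ring) (by ring) (by omega) (by omega) _
      (by simp [Quad.rearrangements])
  · exact row (⟨8 * m, 9 * m, 11 * m, 14 * m⟩, m) (by simp [rows30]) _
      (by simp [Quad.rearrangements])
  · exact row (⟨4 * m, 5 * m, 9 * m, 14 * m⟩, 2 * m) (by simp [rows30]) _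
      (by simp [Quad.rearrangements])

theorem tripleColumn_correct {k m : ℕ} (hk : 0 < k) (hkm : k = 30 * m) :
    ∀ r ∈ tripleColumn m, r.2 ∈ TripleOverlaps k ∧ ∃ o ∈ r.2.constituents, Sim k r.1 o := by
  obtain ⟨h1, h2, h3, h4, h5⟩ := tripleOverlaps_thirty hk hkm
  intro r hr
  simp only [tripleColumn, List.mem_cons, List.not_mem_nil, or_false] at hr
  rcases hr with rfl | rfl | rfl | rfl | rfl | rfl | rfl | rfl | rfl
  · exact ⟨h1, ⟨3 * m, 5 * m, 5 * m, 9 * m⟩, by simp [Triple.constituents, T1],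
      sim_of_mem_rearrangements k (by simp [Quad.rearrangements])⟩
  · exact ⟨h2, ⟨m, 2 * m, 4 * m, 9 * m⟩, by simp [Triple.constituents, T2],
      sim_of_mem_rearrangements k (by simp [Quad.rearrangements])⟩
  · exact ⟨h3, ⟨2 * m, 3 * m, 5 * m, 8 * m⟩, by simp [Triple.constituents, T3],
      sim_of_mem_rearrangements k (by simp [Quad.rearrangements])⟩
  · exact ⟨h4, ⟨2 * m, 5 * m, 3 * m, 8 * m⟩, by simp [Triple.constituents, T4],
      sim_of_mem_rearrangements k (by simp [Quad.rearrangements])⟩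
  · exact ⟨h5, ⟨8 * m, 11 * m, 9 * m, 14 * m⟩, by simp [Triple.constituents, T5],
      sim_of_mem_rearrangements k (by simp [Quad.rearrangements])⟩
  · exact ⟨h3, ⟨2 * m, 3 * m, 7 * m, 14 * m⟩, by simp [Triple.constituents, T3],
      sim_of_mem_rearrangements k (by simp [Quad.rearrangements])⟩
  · exact ⟨h4, ⟨3 * m, 8 * m, 4 * m, 13 * m⟩, by simp [Triple.constituents, T4],
      sim_of_mem_rearrangements k (by simp [Quad.rearrangements])⟩
  · exact ⟨h2, ⟨4 * m, 9 * m, 5 * m, 14 * m⟩, by simp [Triple.constituents, T2],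
      sim_of_mem_rearrangements k (by simp [Quad.rearrangements])⟩
  · exact ⟨h5, ⟨4 * m, 5 * m, 9 * m, 14 * m⟩, by simp [Triple.constituents, T5],
      sim_of_mem_rearrangements k (by simp [Quad.rearrangements])⟩

end CircularOverlap

theorem theorem26 (k : ℕ) (hk : 3 ≤ k) (heven : Even k) :
    -- a nontrivial overlap forces `6 ∣ k`
    ((CircularOverlap.O k).Nonempty → ∃ l : ℕ, k = 6 * l) ∧
    -- the nontrivial overlaps are exactly the members of the four families
    CircularOverlap.O k =
      CircularOverlap.O1 k ∪ CircularOverlap.O30 k ∪ CircularOverlap.O42 k ∪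
        CircularOverlap.O60 k ∧
    -- the identity behind the first family (the exponent `ℓ - u` may be negative)
    (∀ l u : ℕ, k = 6 * l → 1 ≤ u → u ≤ k / 4 → u ≠ l →
      CircularOverlap.phi k ^ ((l : ℤ) - (u : ℤ)) * CircularOverlap.c k u l =
        CircularOverlap.c k (2 * u) (3 * l - u)) ∧
    -- the three finite lists: normalized forms and values of `ω`
    CircularOverlap.RowsCorrect 30 CircularOverlap.rows30 k ∧
    CircularOverlap.RowsCorrect 42 CircularOverlap.rows42 k ∧
    CircularOverlap.RowsCorrect 60 CircularOverlap.rows60 k ∧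
    -- the triple overlaps recorded next to the list for `30 ∣ k`
    (∀ m : ℕ, k = 30 * m → ∀ r ∈ CircularOverlap.tripleColumn m,
      r.2 ∈ CircularOverlap.TripleOverlaps k ∧
        ∃ o ∈ r.2.constituents, CircularOverlap.Sim k r.1 o) := by
  have hk0 : 0 < k := by omega
  have hunion := CircularOverlap.O_eq_union hk0 heven
  refine ⟨?_, hunion, fun l u hl h1 h2 _ => CircularOverlap.parametric_identity hk0 hl h1 h2,
    CircularOverlap.rowsCorrect_of_identity (by norm_num)
      (fun _ => CircularOverlap.rows30_normalized hk0) (fun _ => CircularOverlap.rows30_identity hk0),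
    CircularOverlap.rowsCorrect_of_identity (by norm_num)
      (fun _ => CircularOverlap.rows42_normalized hk0) (fun _ => CircularOverlap.rows42_identity hk0),
    CircularOverlap.rowsCorrect_of_identity (by norm_num)
      (fun _ => CircularOverlap.rows60_normalized hk0) (fun _ => CircularOverlap.rows60_identity hk0),
    fun m hm => CircularOverlap.tripleColumn_correct hk0 hm⟩
  rintro ⟨o, ho⟩
  rw [hunion] at ho
  rcases ho with ((⟨l, _, hl, _⟩ | ⟨m, hm, _⟩) | ⟨m, hm, _⟩) | ⟨m, hm, _⟩
  · exact ⟨l, hl⟩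
  · exact ⟨5 * m, by omega⟩
  · exact ⟨7 * m, by omega⟩
  · exact ⟨10 * m, by omega⟩
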